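/- \textbf{The algorithm.} There are $n$ clients. Client $i$ holds a local dataset $D_i=(x_{i1},\dots,x_{iK_i})$ of samples from a set $\mathcal X$, with $K_{\min}\le K_i\le K_{\max}$ and $K_{\min}\ge1$. Public inputs are: integers $1\le m\le n$ and $k\ge1$, the expected batch size $b=m/k$, a number of rounds $T\ge 0$, a clipping constant $C>0$, noise levels $\sigma_s,\sigma_0>0$, a floor $z_{\min}>0$, a cap $\tilde N>0$, learning rates $\eta_t\in\mathbb R$, an initial model $w_0\in\mathbb R^p$, and losses $f_i(w;x)$ that are differentiable in $w\in\mathbb R^p$. In round $t=0,\dots,T-1$, with fresh independent randomness: \begin{enumerate} \item Each client is put into $\mathcal X_t$ independently with probability $m/n$. \item Each $i\in\mathcal X_t$ computes $g_i=\frac1{K_i}\sum_{j}\nabla f_i(w_t;x_{ij})$, clips it to $\bar g_i=g_i/\max\{1,\|g_i\|_2/C\}$, and sends $\tilde z_i=\|\bar g_i\|_2+v_i$, where $v_i\sim\mathcal N(0,\sigma_s^2)$ is scalar. \item Put $\hat z_i=z_{\min}$ if $\tilde z_i<0$ and $\hat z_i=\tilde z_i$ otherwise, $\tilde z_S'=\min\{\max\{\sum_{i\in\mathcal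 X_t}\hat z_i,\,bC\},\,\tilde N C\}$ and $p_{j,t}=\min\{1,\,b\hat z_j/(k\tilde z_S')\}$. Given all this, each $j\in\mathcal X_t$ is put into $\mathcal Z_t$ independently with probability $p_{j,t}/k$. \item Each $l\in\mathcal Z_t$ sends $\bar g_l+u_l$, where $u_l\sim\mathcal N(0,\sigma_0^2 I_p)$, and the server sets $w_{t+1}=w_t-\eta_t\,\frac1b\sum_{l\in\mathcal Z_t}(\bar g_l+u_l)$. \end{enumerate} The \emph{output} is $w_T$. The \emph{view} consists of $\mathcal X_t$, $(\tilde z_i)_{i\in\mathcal X_t}$, $\mathcal Z_t$, $(\bar g_l+u_l)_{l\in\mathcal Z_t}$ for all $t<T$, together with $w_T$. \textbf{Privacy.} $D=(D_1,\dots,D_n)$ and $D'$ are neighbours if they differ in the local dataset of at most one client. A mechanism $M$ is $(\epsilon,\delta)$-DP if $\Pr[M(D)\in S]\le e^{\epsilon}\Pr[M(D')\in S]+\delta$ for all neighbours $D,D'$ and all measurable $S$. It is $(\alpha,\tau)$-RDP if $D_\alpha(M(D)\|M(D'))\le\tau$ for all neighbours, where $D_\alpha(P\|Q)=\frac1{\alpha-1}\ln\int(\frac{dP}{dQ})^\alpha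 dQ$ (and $+\infty$ if $P\not\ll Q$). Write $$\epsilon_s(\alpha)=\frac{\alpha C^2}{2\sigma_s^2},\qquad \epsilon_0(\alpha)=\frac{\alpha(2C)^2}{2\sigma_0^2},\qquad \tau_T(\alpha)=T\,(\epsilon_s(\alpha)+\epsilon_0(\alpha)).$$ \textbf{Theorem.} The algorithm is $(\epsilon,\delta)$-differentially private in the following sense. \begin{enumerate} \item (Strong composition.) Let $\epsilon_{step},\delta_{step}\in(0,1)$, $c_0=2\sqrt{\ln(1.25/\delta_{step})}$, and suppose $\sigma_s,\sigma_0\ge C c_0/\epsilon_{step}$. Then the view and the output are $(\epsilon,\delta)$-DP with $$\epsilon=\epsilon_{step}\sqrt{2T\ln(1/\delta_{step})}+T\,\frac{e^{\epsilon_{step}}-1}{e^{\epsilon_{step}}+1},\qquad \delta=(T+1)\,\delta_{step}.$$ \item (R\'enyi DP.) For every $\alpha>1$ the view and the output are $(\alpha,\tau_T(\alpha))$-RDP. \item (Conversion.) For every $\alpha>1$, $\delta\in(0,1)$ and $\epsilon\ge0$ with $$\epsilon\ \ge\ \tau_T(\alpha)+\frac{\log(1/\delta)+(\alpha-1)\log(1-1/\alpha)-\log\alpha}{\alpha-1},\qquad(*)$$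 the view and the output are $(\epsilon,\delta)$-DP. \item (Expected charge.) For every $\alpha>1$, dataset $D$ and round $t<T$, $\ \mathbb E\big[|\mathcal X_t|\,\epsilon_s(\alpha)+|\mathcal Z_t|\,\epsilon_0(\alpha)\big]\le m\,\epsilon_s(\alpha)+b\,\epsilon_0(\alpha)$. \item (Every target can be met.) For every $\epsilon>0$ and $\delta\in(0,1)$ there are $\alpha>1$ and $\sigma>0$ such that $(*)$ holds whenever $\sigma_s,\sigma_0\ge\sigma$. \end{enumerate} -/

import Mathlib

open MeasureTheory ProbabilityTheory
open scoped NNReal ENNReal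

namespace LOCKS

/-! ### Differential privacy -/

/-- Two datasets of `n` client records are neighbours if they differ in at most one record. -/
def Neighbor {n : ℕ} {𝒟 : Type*} (x x' : Fin n → 𝒟) : Prop :=
  ∃ i, ∀ j, j ≠ i → x j = x' j

/-- `(ε, δ)`-differential privacy of a randomized mechanism, given by its output laws. -/
def IsDP {n : ℕ} {𝒟 Ω : Type*} [MeasurableSpace Ω]
    (M : (Fin n → 𝒟) → Measure Ω) (ε δ : ℝ) : Prop :=
  ∀ x x', Neighbor x x' → ∀ S, MeasurableSet S →
    M x S ≤ ENNReal.ofReal (Real.exp ε) * M x' S + ENNReal.ofReal δ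

open Classical in
/-- Rényi divergence `(α - 1)⁻¹ log ∫ (dP/dQ)^α dQ` of order `α > 1`,
infinite if `P` is not absolutely continuous with respect to `Q`. -/
noncomputable def renyiDiv {Ω : Type*} [MeasurableSpace Ω] (α : ℝ) (P Q : Measure Ω) : EReal :=
  if P ≪ Q then
    (((α - 1)⁻¹ : ℝ) : EReal) * ENNReal.log (∫⁻ ω, (P.rnDeriv Q ω) ^ α ∂Q)
  else ⊤

/-- `(α, τ)`-Rényi differential privacy. -/
def IsRDP {n : ℕ} {𝒟 Ω : Type*} [MeasurableSpace Ω]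
    (M : (Fin n → 𝒟) → Measure Ω) (α τ : ℝ) : Prop :=
  ∀ x x', Neighbor x x' → renyiDiv α (M x) (M x') ≤ (τ : EReal)

/-! ### The algorithm -/

/-- Model parameters, with the Euclidean norm. -/
abbrev Param (p : ℕ) : Type := EuclideanSpace ℝ (Fin p)

/-- The local dataset of one client: between `Kmin` and `Kmax` samples. -/
structure LocalData (𝒳 : Type*) (Kmin Kmax : ℕ) where
  size : ℕ
  min_le : Kmin ≤ size
  le_max : size ≤ Kmax
  sample : Fin size → 𝒳

/-- The public inputs of the algorithm for `n` clients and `p` model parameters. -/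
structure Config (n p : ℕ) (𝒳 : Type*) where
  /-- expected number of clients in the first sampling stage -/
  m : ℕ
  /-- reduction factor of the second sampling stage -/
  k : ℕ
  /-- clipping constant -/
  C : ℝ
  /-- noise standard deviation for the gradient norms -/
  σs : ℝ≥0
  /-- noise standard deviation for each coordinate of the gradients -/
  σ0 : ℝ≥0
  /-- value that replaces a negative noisy norm -/
  floor : ℝ
  /-- the constant `Ñ` in the upper cap `Ñ C` on the sum of the noisy norms -/
  cap : ℝ
  /-- server learning rates -/
  η : ℕ → ℝ
  /-- initial model -/
  w0 : Param p
  /-- `loss i w x` is the loss of client `i` at the model `w` on the sample `x` -/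
  loss : Fin n → Param p → 𝒳 → ℝ

/-- What is sent to or seen by the server in one round: which clients are in the first sample,
their noisy norms, which clients are in the second sample, their noisy clipped gradients.
The entry of a client that sends nothing is `0`. -/
abbrev Message (n p : ℕ) : Type :=
  (Fin n → Bool) × (Fin n → ℝ) × (Fin n → Bool) × (Fin n → Param p)

/-- The random draws of one round: one uniform variable per client for the first sampling stage,
one scalar Gaussian per client for the norm, one uniform variable per client for the second
sampling stage, one Gaussian vector per client for the gradient. -/
abbrev Seed (n p : ℕ) : Type :=
  (Fin n → unitInterval) × (Fin n → ℝ) × (Fin n → unitInterval) × (Fin n → Fin p → ℝ)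

/-- Clipping of a vector to norm at most `C`. -/
noncomputable def clip {p : ℕ} (C : ℝ) (g : Param p) : Param p :=
  (max 1 (‖g‖ / C))⁻¹ • g

/-- The expected batch size `b = m / k`. -/
noncomputable def batch (m k : ℕ) : ℝ := (m : ℝ) / (k : ℝ)

variable {n p : ℕ} {𝒳 : Type*} {Kmin Kmax : ℕ}

namespace Config

/-- The clipped average gradient of client `i` at `w`. -/
noncomputable def clippedGrad (A : Config n p 𝒳) (i : Fin n) (D : LocalData 𝒳 Kmin Kmax)
    (w : Param p) : Param p :=
  clip A.C ((D.size : ℝ)⁻¹ • ∑ j, gradient (fun v => A.loss i v (D.sample j)) w)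

/-- First sampling stage: each client is picked independently with probability `m / n`. -/
noncomputable def first (A : Config n p 𝒳) (U : Fin n → unitInterval) : Fin n → Bool :=
  fun i => decide ((U i : ℝ) < (A.m : ℝ) / (n : ℝ))

/-- Noisy norms `z̃ᵢ` of the clients in the first sample. -/
noncomputable def noisyNorms (A : Config n p 𝒳) (D : Fin n → LocalData 𝒳 Kmin Kmax)
    (w : Param p) (X : Fin n → Bool) (v : Fin n → ℝ) : Fin n → ℝ :=
  fun i => if X i = true then ‖A.clippedGrad i (D i) w‖ + v i else 0

/-- Negative noisy norms are replaced by the floor. -/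
noncomputable def floored (A : Config n p 𝒳) (z : Fin n → ℝ) : Fin n → ℝ :=
  fun i => if z i < 0 then A.floor else z i

/-- The clipped sum of the noisy norms over the first sample. -/
noncomputable def normSum (A : Config n p 𝒳) (X : Fin n → Bool) (z : Fin n → ℝ) : ℝ :=
  min (max (∑ i, if X i = true then A.floored z i else 0) (batch A.m A.k * A.C)) (A.cap * A.C)

/-- The numbers `p_j` that the second sampling stage uses. -/
noncomputable def weight (A : Config n p 𝒳) (X : Fin n → Bool) (z : Fin n → ℝ) : Fin n → ℝ :=
  fun j => min 1 (batch A.m A.k * A.floored z j / ((A.k : ℝ) * A.normSum X z))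

/-- Second sampling stage: each client of the first sample is kept independently with
probability `p_j / k`. -/
noncomputable def second (A : Config n p 𝒳) (X : Fin n → Bool) (z : Fin n → ℝ)
    (U : Fin n → unitInterval) : Fin n → Bool :=
  fun j => X j && decide ((U j : ℝ) < A.weight X z j / (A.k : ℝ))

/-- Noisy clipped gradients of the clients in the second sample. -/
noncomputable def noisyGrads (A : Config n p 𝒳) (D : Fin n → LocalData 𝒳 Kmin Kmax)
    (w : Param p) (Z : Fin n → Bool) (u : Fin n → Fin p → ℝ) : Fin n → Param p :=
  fun l => if Z l = true then A.clippedGrad l (D l) w + WithLp.toLp 2 (u l) else 0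

/-- All messages of one round at the model `w`, as a function of the random draws. -/
noncomputable def message (A : Config n p 𝒳) (D : Fin n → LocalData 𝒳 Kmin Kmax)
    (w : Param p) (ξ : Seed n p) : Message n p :=
  let X := A.first ξ.1
  let z := A.noisyNorms D w X ξ.2.1
  let Z := A.second X z ξ.2.2.1
  (X, z, Z, A.noisyGrads D w Z ξ.2.2.2)

/-- The server update in round `t`. -/
noncomputable def update (A : Config n p 𝒳) (t : ℕ) (w : Param p) (r : Message n p) : Param p :=
  w - A.η t • ((batch A.m A.k)⁻¹ • ∑ l, if r.2.2.1 l = true then r.2.2.2 l else 0)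

/-- One round: append its messages to the transcript and update the model. -/
noncomputable def step (A : Config n p 𝒳) (D : Fin n → LocalData 𝒳 Kmin Kmax) (t : ℕ)
    (s : ((Fin t → Message n p) × Param p) × Seed n p) :
    (Fin (t + 1) → Message n p) × Param p :=
  (Fin.snoc s.1.1 (A.message D s.1.2 s.2), A.update t s.1.2 (A.message D s.1.2 s.2))

/-- The law of the random draws of one round. -/
noncomputable def seedLaw (A : Config n p 𝒳) : Measure (Seed n p) :=
  (volume : Measure (Fin n → unitInterval)).prod
    ((Measure.pi fun _ => gaussianReal 0 (A.σs ^ 2)).prod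
      ((volume : Measure (Fin n → unitInterval)).prod
        (Measure.pi fun _ => Measure.pi fun _ => gaussianReal 0 (A.σ0 ^ 2))))

/-- The joint law of the transcript of the first `t` rounds and of the model `w_t`,
with fresh independent draws in each round. -/
noncomputable def view (A : Config n p 𝒳) :
    (t : ℕ) → (Fin n → LocalData 𝒳 Kmin Kmax) → Measure ((Fin t → Message n p) × Param p)
  | 0, _ => Measure.dirac (Fin.elim0, A.w0)
  | t + 1, D => ((A.view t D).prod A.seedLaw).map (A.step D t)

/-- The law of the model `w_t` after `t` rounds. -/
noncomputable def output (A : Config n p 𝒳) (t : ℕ) (D : Fin n → LocalData 𝒳 Kmin Kmax) :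
    Measure (Param p) :=
  (A.view t D).map Prod.snd

end Config

/-! ### The laws above are probability measures -/

namespace Config

instance (A : Config n p 𝒳) : IsProbabilityMeasure A.seedLaw := by
  unfold seedLaw; infer_instance

theorem measurable_clippedGrad (A : Config n p 𝒳) (i : Fin n) (D : LocalData 𝒳 Kmin Kmax) :
    Measurable (A.clippedGrad i D) := by
  have h : ∀ j, Measurable (gradient (fun v => A.loss i v (D.sample j))) := fun j =>
    (LinearIsometryEquiv.continuous _).measurable.comp (measurable_fderiv ℝ _)
  have h2 : Measurable fun w => (D.size : ℝ)⁻¹ •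
      ∑ j, gradient (fun v => A.loss i v (D.sample j)) w :=
    (Finset.measurable_fun_sum _ fun j _ => h j).fun_const_smul _
  unfold clippedGrad clip
  exact ((measurable_const.max (h2.norm.div_const _)).inv).smul h2

theorem measurable_first (A : Config n p 𝒳) : Measurable A.first := by
  refine measurable_pi_lambda _ fun i => ?_
  refine measurable_to_bool ?_
  have : (fun U : Fin n → unitInterval => A.first U i) ⁻¹' {true} =
      {U | (U i : ℝ) < (A.m : ℝ) / (n : ℝ)} := by ext; simp [first]
  rw [this]
  exact measurableSet_lt (measurable_subtype_coe.comp (measurable_pi_apply i)) measurable_const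

theorem measurable_noisyNorms (A : Config n p 𝒳) (D : Fin n → LocalData 𝒳 Kmin Kmax) :
    Measurable fun q : Param p × (Fin n → Bool) × (Fin n → ℝ) =>
      A.noisyNorms D q.1 q.2.1 q.2.2 := by
  refine measurable_pi_lambda _ fun i => ?_
  have hg := A.measurable_clippedGrad i (D i)
  refine Measurable.ite ?_ ?_ measurable_const
  · exact measurableSet_eq_fun ((measurable_pi_apply i).comp measurable_snd.fst) measurable_const
  · exact (hg.comp measurable_fst).norm.add ((measurable_pi_apply i).comp measurable_snd.snd)

theorem measurable_floored (A : Config n p 𝒳) : Measurable A.floored := by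
  refine measurable_pi_lambda _ fun i => ?_
  exact Measurable.ite (measurableSet_lt (measurable_pi_apply i) measurable_const)
    measurable_const (measurable_pi_apply i)

theorem measurable_normSum (A : Config n p 𝒳) :
    Measurable fun q : (Fin n → Bool) × (Fin n → ℝ) => A.normSum q.1 q.2 := by
  unfold normSum
  refine ((Finset.measurable_fun_sum _ fun i _ => ?_).max measurable_const).min measurable_const
  refine Measurable.ite ?_ ?_ measurable_const
  · exact measurableSet_eq_fun ((measurable_pi_apply i).comp measurable_fst) measurable_const
  · exact (measurable_pi_apply i).comp (A.measurable_floored.comp measurable_snd)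

theorem measurable_weight (A : Config n p 𝒳) :
    Measurable fun q : (Fin n → Bool) × (Fin n → ℝ) => A.weight q.1 q.2 := by
  refine measurable_pi_lambda _ fun i => ?_
  unfold weight
  exact measurable_const.min ((((measurable_pi_apply i).comp
    (A.measurable_floored.comp measurable_snd)).const_mul _).div
      (A.measurable_normSum.const_mul _))

theorem measurable_second (A : Config n p 𝒳) :
    Measurable fun q : ((Fin n → Bool) × (Fin n → ℝ)) × (Fin n → unitInterval) =>
      A.second q.1.1 q.1.2 q.2 := by
  refine measurable_pi_lambda _ fun i => ?_
  refine measurable_to_bool ?_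
  have : (fun q : ((Fin n → Bool) × (Fin n → ℝ)) × (Fin n → unitInterval) =>
      A.second q.1.1 q.1.2 q.2 i) ⁻¹' {true} =
      {q | q.1.1 i = true} ∩ {q | (q.2 i : ℝ) < A.weight q.1.1 q.1.2 i / (A.k : ℝ)} := by
    ext; simp [second]
  rw [this]
  refine MeasurableSet.inter ?_ ?_
  · exact measurableSet_eq_fun ((measurable_pi_apply i).comp measurable_fst.fst) measurable_const
  · exact measurableSet_lt
      (measurable_subtype_coe.comp ((measurable_pi_apply i).comp measurable_snd))
      (((measurable_pi_apply i).comp (A.measurable_weight.comp measurable_fst)).div_const _)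

theorem measurable_noisyGrads (A : Config n p 𝒳) (D : Fin n → LocalData 𝒳 Kmin Kmax) :
    Measurable fun q : Param p × (Fin n → Bool) × (Fin n → Fin p → ℝ) =>
      A.noisyGrads D q.1 q.2.1 q.2.2 := by
  refine measurable_pi_lambda _ fun i => ?_
  have hg := A.measurable_clippedGrad i (D i)
  refine Measurable.ite ?_ ?_ measurable_const
  · exact measurableSet_eq_fun ((measurable_pi_apply i).comp measurable_snd.fst) measurable_const
  · exact (hg.comp measurable_fst).add ((WithLp.measurable_toLp 2 _).comp
      ((measurable_pi_apply i).comp measurable_snd.snd))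

theorem measurable_message (A : Config n p 𝒳) (D : Fin n → LocalData 𝒳 Kmin Kmax) :
    Measurable fun q : Param p × Seed n p => A.message D q.1 q.2 := by
  have hX : Measurable fun q : Param p × Seed n p => A.first q.2.1 :=
    A.measurable_first.comp measurable_snd.fst
  have hz : Measurable fun q : Param p × Seed n p =>
      A.noisyNorms D q.1 (A.first q.2.1) q.2.2.1 :=
    (A.measurable_noisyNorms D).comp
      (measurable_fst.prodMk (hX.prodMk measurable_snd.snd.fst))
  have hZ : Measurable fun q : Param p × Seed n p =>
      A.second (A.first q.2.1) (A.noisyNorms D q.1 (A.first q.2.1) q.2.2.1) q.2.2.2.1 :=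
    A.measurable_second.comp ((hX.prodMk hz).prodMk measurable_snd.snd.snd.fst)
  have hg := (A.measurable_noisyGrads D).comp
      (measurable_fst.prodMk (hZ.prodMk measurable_snd.snd.snd.snd))
  exact hX.prodMk (hz.prodMk (hZ.prodMk hg))

theorem measurable_update (A : Config n p 𝒳) (t : ℕ) :
    Measurable fun q : Param p × Message n p => A.update t q.1 q.2 := by
  unfold update
  refine measurable_fst.sub (Measurable.fun_const_smul (Measurable.fun_const_smul
    (Finset.measurable_fun_sum _ fun i _ => ?_) _) _)
  refine Measurable.ite ?_ ?_ measurable_const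
  · exact measurableSet_eq_fun ((measurable_pi_apply i).comp measurable_snd.snd.snd.fst) measurable_const
  · exact (measurable_pi_apply i).comp measurable_snd.snd.snd.snd

theorem measurable_step (A : Config n p 𝒳) (D : Fin n → LocalData 𝒳 Kmin Kmax) (t : ℕ) :
    Measurable (A.step D t) := by
  have hm : Measurable fun s : ((Fin t → Message n p) × Param p) × Seed n p =>
      A.message D s.1.2 s.2 :=
    (A.measurable_message D).comp (measurable_fst.snd.prodMk measurable_snd)
  refine Measurable.prodMk (measurable_pi_lambda _ fun i => ?_)
    ((A.measurable_update t).comp (measurable_fst.snd.prodMk hm))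
  induction i using Fin.lastCases with
  | last => simpa [Fin.snoc_last] using hm
  | cast i =>
    simp only [Fin.snoc_castSucc]
    exact (measurable_pi_apply i).comp measurable_fst.fst

instance (A : Config n p 𝒳) (t : ℕ) (D : Fin n → LocalData 𝒳 Kmin Kmax) :
    IsProbabilityMeasure (A.view t D) := by
  induction t with
  | zero => unfold view; infer_instance
  | succ t ih =>
    unfold view
    exact Measure.isProbabilityMeasure_map (A.measurable_step D t).aemeasurable

instance (A : Config n p 𝒳) (t : ℕ) (D : Fin n → LocalData 𝒳 Kmin Kmax) :
    IsProbabilityMeasure (A.output t D) :=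
  Measure.isProbabilityMeasure_map measurable_snd.aemeasurable

end Config

/-! ### Privacy accounting -/

/-- Noise standard deviation `c₀ C / ε_step` with `c₀ = 2 √(ln (1.25 / δ_step))`. -/
noncomputable def stepNoise (C εstep δstep : ℝ) : ℝ :=
  2 * Real.sqrt (Real.log (1.25 / δstep)) * C / εstep

/-- Total `ε` of `T` rounds under strong composition. -/
noncomputable def strongEps (T : ℕ) (εstep δstep : ℝ) : ℝ :=
  εstep * Real.sqrt (2 * (T : ℝ) * Real.log (1 / δstep)) +
    (T : ℝ) * ((Real.exp εstep - 1) / (Real.exp εstep + 1))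

/-- Rényi cost `α Δ² / (2 σ²)` of order `α` of a Gaussian mechanism with sensitivity `Δ`. -/
noncomputable def gaussCost (Δ : ℝ) (σ : ℝ≥0) (α : ℝ) : ℝ :=
  α * Δ ^ 2 / (2 * (σ : ℝ) ^ 2)

/-- Rényi cost of one noisy norm: norms of clipped gradients lie in `[0, C]`. -/
noncomputable def normCost (C : ℝ) (σs : ℝ≥0) (α : ℝ) : ℝ := gaussCost C σs α

/-- Rényi cost of one noisy gradient: two clipped gradients have distance at most `2 C`. -/
noncomputable def gradCost (C : ℝ) (σ0 : ℝ≥0) (α : ℝ) : ℝ := gaussCost (2 * C) σ0 α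

/-- The `ε` obtained from `(α, τ)`-RDP at the target `δ`. -/
noncomputable def rdpToEps (α τ δ : ℝ) : ℝ :=
  τ + (Real.log (1 / δ) + (α - 1) * Real.log (1 - 1 / α) - Real.log α) / (α - 1)

/-- The RDP cost of `T` rounds. -/
noncomputable def totalCost (T : ℕ) (C : ℝ) (σs σ0 : ℝ≥0) (α : ℝ) : ℝ :=
  (T : ℝ) * (normCost C σs α + gradCost C σ0 α)

/-- The Rényi cost charged to a round for the noisy norms and noisy gradients sent in it. -/
noncomputable def roundCharge (C : ℝ) (σs σ0 : ℝ≥0) (α : ℝ) (r : Message n p) : ℝ :=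
  ((Finset.univ.filter fun i => r.1 i = true).card : ℝ) * normCost C σs α +
    ((Finset.univ.filter fun i => r.2.2.1 i = true).card : ℝ) * gradCost C σ0 α

end LOCKS

/-!
A change of one dataset acts on the transcript of a round only through the clipped gradient of one
client, hence only through the mean of the Gaussian noise that this client adds: both sampling
stages use the data only through the noisy norms. So the messages for `D` are the messages for
`D'` after a translation of the noise, by at most `C` for the norm and by a vector of length at
most `2 C` for the gradient (`message_eq_message_shiftSeed`). The density of the translated noise
with respect to the original one is an explicit exponential, whose moment of order `α` is
`exp (α (α - 1) Δ² / (2 σ²))` for each translation `Δ` (`lintegral_seedTilt_rpow`). No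
amplification by subsampling is needed.

Rényi divergence is handled as a bound on the `α`-th moment of a likelihood ratio (`RenyiBound`).
Such bounds multiply over rounds, even though the translation depends on the current model
(`RenyiBound.prod_shift`), and they survive measurable maps (`RenyiBound.map`); together this gives
the Rényi bound for the transcript (`renyiBound_view`) and for the final model. The conversion to
approximate differential privacy integrates the pointwise inequality `x ≤ exp ε + c x ^ α` with the
best constant `c` (`le_exp_add_mul_rpow`).

The strong composition bound is deduced from the conversion as well, instead of from a composition
theorem for approximate privacy. With the prescribed noise the Rényi cost of order `α` is at most
`α ρ` with `ρ = 5 T ε² / (8 log (1.25 / δ))`. At the best order, the conversion at the failure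
probability `(T + 1) δ` gives `ρ + 2 √(ρ log (1 / ((T + 1) δ)))`, and this is at most the claimed
`ε` (`exists_rdpToEps_le_strongEps`): the linear term is dominated by `T tanh (ε / 2)` and the
square root by `ε √(2 T log (1 / δ))`, except for one or two rounds with large `δ`, where the
factor `T + 1` makes up for the difference.

The expected charge follows from linearity, as a client is in the first sample with probability
at most `m / n` and is then kept with probability at most `1 / k`.
-/

namespace LOCKS

/-! ### Moments of likelihood ratios -/

/-- `P` has a density with respect to `Q` whose `α`-th moment under `Q` is at most `B`.
For `α > 1` and `B = exp ((α - 1) τ)` this says that the Rényi divergence of order `α` of `P`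
from `Q` is at most `τ`; the density is existentially quantified, so that any version of
it can be exhibited instead of `P.rnDeriv Q`. -/
def RenyiBound {Ω : Type*} [MeasurableSpace Ω] (α : ℝ) (B : ℝ≥0∞) (P Q : Measure Ω) : Prop :=
  ∃ f : Ω → ℝ≥0∞, Measurable f ∧ P = Q.withDensity f ∧ ∫⁻ ω, f ω ^ α ∂Q ≤ B

theorem RenyiBound.refl {Ω : Type*} [MeasurableSpace Ω] {α : ℝ} {Q : Measure Ω}
    [IsProbabilityMeasure Q] : RenyiBound α 1 Q Q :=
  ⟨1, measurable_one, by simp, by simp⟩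

/-- Finiteness of `I` is essential, since `I = ∞` always satisfies the inequality if `B ≠ 0`. -/
theorem le_of_le_rpow_mul_rpow {p q : ℝ} (hpq : p.HolderConjugate q) {I B : ℝ≥0∞}
    (hI : I ≠ ∞) (h : I ≤ B ^ (1 / p) * I ^ (1 / q)) : I ≤ B := by
  rcases eq_or_ne I 0 with rfl | h0
  · exact bot_le
  have hs : I ^ (1 / p) * I ^ (1 / q) = I := by
    rw [← ENNReal.rpow_add _ _ h0 hI, one_div, one_div, hpq.inv_add_inv_eq_one, ENNReal.rpow_one]
  have hq0 : I ^ (1 / q) ≠ 0 := by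
    simp [ENNReal.rpow_eq_zero_iff, h0, hI]
  have hqt : I ^ (1 / q) ≠ ∞ :=
    ENNReal.rpow_ne_top_of_nonneg (one_div_nonneg.2 hpq.symm.nonneg) hI
  have h' : I ^ (1 / p) * I ^ (1 / q) ≤ B ^ (1 / p) * I ^ (1 / q) := by rwa [hs]
  rw [ENNReal.mul_le_mul_iff_left hq0 hqt] at h'
  exact (ENNReal.rpow_le_rpow_iff (one_div_pos.2 hpq.pos)).1 h'

/-- Data processing inequality. With `F` the density of the images, `∫ F ^ α` is
`∫ F(h) ^ (α - 1) f ∂Q`, and Hölder's inequality bounds it by a power of itself times a power of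
`∫ f ^ α`. Truncation of `F` makes the integral finite, so that it can be cancelled. -/
theorem RenyiBound.map {Ω Ω' : Type*} [MeasurableSpace Ω] [MeasurableSpace Ω'] {α : ℝ}
    {B : ℝ≥0∞} {P Q : Measure Ω} [IsFiniteMeasure P] [IsFiniteMeasure Q] (hα : 1 < α)
    {h : Ω → Ω'} (hh : Measurable h) (hPQ : RenyiBound α B P Q) :
    RenyiBound α B (P.map h) (Q.map h) := by
  obtain ⟨f, hf, hP, hB⟩ := hPQ
  have hac : P.map h ≪ Q.map h := by
    refine Measure.AbsolutelyContinuous.map ?_ hh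
    rw [hP]; exact withDensity_absolutelyContinuous _ _
  set F := (P.map h).rnDeriv (Q.map h) with hF
  have hFm : Measurable F := Measure.measurable_rnDeriv _ _
  have hFP : (Q.map h).withDensity F = P.map h := Measure.withDensity_rnDeriv_eq _ _ hac
  refine ⟨F, hFm, hFP.symm, ?_⟩
  have hα0 : 0 < α - 1 := by linarith
  have hpq : α.HolderConjugate (Real.conjExponent α) := .conjExponent hα
  have hexp : (α - 1) * Real.conjExponent α = α := by
    unfold Real.conjExponent; field_simp
  have hGm : ∀ N : ℕ, Measurable fun ω => min (F ω) (N : ℝ≥0∞) := fun N =>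
    hFm.min measurable_const
  have key : ∀ N : ℕ, ∫⁻ ω, (min (F ω) (N : ℝ≥0∞)) ^ α ∂(Q.map h) ≤ B := by
    intro N
    refine le_of_le_rpow_mul_rpow hpq ?_ ?_
    · refine ne_of_lt (lt_of_le_of_lt (lintegral_mono (g := fun _ => (N : ℝ≥0∞) ^ α) fun ω =>
        ENNReal.rpow_le_rpow (min_le_right _ _) (by linarith)) ?_)
      rw [lintegral_const]
      exact ENNReal.mul_lt_top (ENNReal.rpow_lt_top_of_nonneg (by linarith) (by simp))
        (measure_lt_top _ _)
    · calc ∫⁻ ω, (min (F ω) (N : ℝ≥0∞)) ^ α ∂(Q.map h)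
          ≤ ∫⁻ ω, F ω * (min (F ω) (N : ℝ≥0∞)) ^ (α - 1) ∂(Q.map h) := by
            refine lintegral_mono fun ω => ?_
            have : (min (F ω) (N : ℝ≥0∞)) ^ α
                = min (F ω) (N : ℝ≥0∞) * (min (F ω) (N : ℝ≥0∞)) ^ (α - 1) := by
              conv_lhs => rw [show α = 1 + (α - 1) by ring]
              rw [ENNReal.rpow_add_of_nonneg _ _ zero_le_one hα0.le, ENNReal.rpow_one]
            simp only [this]
            gcongr
            exact min_le_left _ _
        _ = ∫⁻ ω, (min (F ω) (N : ℝ≥0∞)) ^ (α - 1) ∂(P.map h) := by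
            conv_rhs => rw [← hFP]
            rw [lintegral_withDensity_eq_lintegral_mul _ hFm ((hGm N).pow_const _)]
            rfl
        _ = ∫⁻ ω, (f * fun ω => (min (F (h ω)) (N : ℝ≥0∞)) ^ (α - 1)) ω ∂Q := by
            have hm : Measurable fun ω => (min (F (h ω)) (N : ℝ≥0∞)) ^ (α - 1) :=
              ((hGm N).comp hh).pow_const _
            rw [lintegral_map ((hGm N).pow_const _) hh, hP,
              lintegral_withDensity_eq_lintegral_mul _ hf hm]
        _ ≤ (∫⁻ ω, f ω ^ α ∂Q) ^ (1 / α) *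
              (∫⁻ ω, ((min (F (h ω)) (N : ℝ≥0∞)) ^ (α - 1)) ^ Real.conjExponent α ∂Q) ^
                (1 / Real.conjExponent α) :=
            ENNReal.lintegral_mul_le_Lp_mul_Lq _ hpq hf.aemeasurable
              (((hGm N).comp hh).pow_const _).aemeasurable
        _ ≤ _ := by
            rw [lintegral_map ((hGm N).pow_const _) hh]
            simp only [← ENNReal.rpow_mul, hexp]
            gcongr
  refine le_of_tendsto' (lintegral_tendsto_of_tendsto_of_monotone
    (f := fun (N : ℕ) ω => (min (F ω) (N : ℝ≥0∞)) ^ α)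
    (fun N => ((hGm N).pow_const _).aemeasurable) ?_ ?_) key
  · refine ae_of_all _ fun ω i j hij => ENNReal.rpow_le_rpow ?_ (by linarith)
    exact min_le_min le_rfl (by exact_mod_cast hij)
  · refine ae_of_all _ fun ω => ?_
    refine (ENNReal.continuous_rpow_const.tendsto _).comp ?_
    have := (tendsto_const_nhds (x := F ω)).min ENNReal.tendsto_nat_nhds_top
    simpa using this

/-- Adaptive composition: the second component is drawn from `ν` and then moved by a map `ψ s`
that depends on the first component `s`. The likelihood ratios multiply. -/
theorem RenyiBound.prod_shift {S Ξ : Type*} [MeasurableSpace S] [MeasurableSpace Ξ] {α : ℝ}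
    {B B' : ℝ≥0∞} {P Q : Measure S} [SFinite P] [SFinite Q] {ν : Measure Ξ} [SFinite ν]
    (hα : 0 ≤ α) (hPQ : RenyiBound α B P Q) {ψ : S → Ξ → Ξ} (hψ : Measurable (Function.uncurry ψ))
    {g : S → Ξ → ℝ≥0∞} (hg : Measurable (Function.uncurry g))
    (hν : ∀ s, ν.map (ψ s) = ν.withDensity (g s)) (hB' : ∀ s, ∫⁻ ξ, g s ξ ^ α ∂ν ≤ B') :
    RenyiBound α (B * B') ((P.prod ν).map fun q => (q.1, ψ q.1 q.2)) (Q.prod ν) := by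
  obtain ⟨f, hf, hP, hB⟩ := hPQ
  have hm : Measurable fun q : S × Ξ => (q.1, ψ q.1 q.2) := measurable_fst.prodMk hψ
  have hψs : ∀ s, Measurable (ψ s) := fun s => hψ.comp measurable_prodMk_left
  have hgs : ∀ s, Measurable (g s) := fun s => hg.comp measurable_prodMk_left
  have hd : Measurable fun q : S × Ξ => f q.1 * g q.1 q.2 := (hf.comp measurable_fst).mul hg
  refine ⟨fun q => f q.1 * g q.1 q.2, hd, ?_, ?_⟩
  · refine Measure.ext_of_lintegral _ fun φ hφ => ?_
    rw [lintegral_map hφ hm, lintegral_prod (fun q : S × Ξ => φ (q.1, ψ q.1 q.2))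
      (hφ.comp hm).aemeasurable,
      lintegral_withDensity_eq_lintegral_mul _ hd hφ, lintegral_prod _ (hd.mul hφ).aemeasurable]
    have hφs : ∀ s, Measurable fun ξ => φ (s, ξ) := fun s => hφ.comp measurable_prodMk_left
    have h1 : ∀ s, ∫⁻ ξ, φ (s, ψ s ξ) ∂ν = ∫⁻ ξ, g s ξ * φ (s, ξ) ∂ν := fun s => by
      rw [← lintegral_map (hφs s) (hψs s), hν,
        lintegral_withDensity_eq_lintegral_mul _ (hgs s) (hφs s)]
      rfl
    have h2 : Measurable fun s => ∫⁻ ξ, g s ξ * φ (s, ξ) ∂ν :=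
      Measurable.lintegral_prod_right' (f := fun q : S × Ξ => g q.1 q.2 * φ q) (hg.mul hφ)
    simp only [h1]
    rw [hP, lintegral_withDensity_eq_lintegral_mul _ hf h2]
    refine lintegral_congr fun s => ?_
    have h3 : Measurable fun ξ => g s ξ * φ (s, ξ) := (hgs s).mul (hφs s)
    simp only [Pi.mul_apply]
    rw [← lintegral_const_mul _ h3]
    simp only [mul_assoc]
  · rw [lintegral_prod _ (hd.pow_const _).aemeasurable]
    calc ∫⁻ s, ∫⁻ ξ, (f s * g s ξ) ^ α ∂ν ∂Q
        = ∫⁻ s, f s ^ α * ∫⁻ ξ, g s ξ ^ α ∂ν ∂Q := by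
          refine lintegral_congr fun s => ?_
          simp only [ENNReal.mul_rpow_of_nonneg _ _ hα]
          rw [lintegral_const_mul _ ((hgs s).pow_const _)]
      _ ≤ ∫⁻ s, f s ^ α * B' ∂Q := lintegral_mono fun s => by gcongr; exact hB' s
      _ = (∫⁻ s, f s ^ α ∂Q) * B' := lintegral_mul_const _ (hf.pow_const _)
      _ ≤ B * B' := by gcongr

/-- Any density agrees almost everywhere with the Radon-Nikodym derivative in `renyiDiv`. -/
theorem RenyiBound.renyiDiv_le {Ω : Type*} [MeasurableSpace Ω] {α τ : ℝ} {P Q : Measure Ω}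
    [SigmaFinite Q] (hα : 1 < α)
    (h : RenyiBound α (ENNReal.ofReal (Real.exp ((α - 1) * τ))) P Q) :
    renyiDiv α P Q ≤ (τ : EReal) := by
  obtain ⟨f, hf, rfl, hB⟩ := h
  rw [renyiDiv, if_pos (withDensity_absolutelyContinuous _ _)]
  have h1 : ∫⁻ ω, ((Q.withDensity f).rnDeriv Q ω) ^ α ∂Q = ∫⁻ ω, f ω ^ α ∂Q := by
    refine lintegral_congr_ae ?_
    filter_upwards [Measure.rnDeriv_withDensity Q hf] with ω hω
    rw [hω]
  have hα0 : 0 < α - 1 := by linarith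
  rw [h1]
  calc (((α - 1)⁻¹ : ℝ) : EReal) * ENNReal.log (∫⁻ ω, f ω ^ α ∂Q)
      ≤ (((α - 1)⁻¹ : ℝ) : EReal) * (((α - 1) * τ : ℝ) : EReal) := by
        refine mul_le_mul_of_nonneg_left ?_ (by exact_mod_cast (inv_pos.2 hα0).le)
        refine (ENNReal.log_monotone hB).trans_eq ?_
        rw [ENNReal.log_ofReal_of_pos (Real.exp_pos _), Real.log_exp]
    _ = (τ : EReal) := by
        rw [← EReal.coe_mul, inv_mul_cancel_left₀ hα0.ne']

/-! ### From Rényi to approximate differential privacy -/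

/-- The constant is the maximum of `(x - exp ε) / x ^ α`, attained at `x = exp ε * α / (α - 1)`;
the inequality is Bernoulli's inequality around that point. -/
theorem le_exp_add_mul_rpow {α ε x : ℝ} (hα : 1 < α) (hx : 0 ≤ x) :
    x ≤ Real.exp ε +
      Real.exp (-(α - 1) * ε + (α - 1) * Real.log (1 - 1 / α) - Real.log α) * x ^ α := by
  have hα0 : 0 < α := by linarith
  have hα1 : 0 < α - 1 := by linarith
  set r := (1 - 1 / α) * Real.exp (-ε) with hr
  have h1α : 1 - 1 / α = (α - 1) / α := by field_simp
  have hq : 0 < 1 - 1 / α := by rw [h1α]; positivity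
  have hr0 : 0 < r := by positivity
  have hrl : Real.log r = Real.log (1 - 1 / α) - ε := by
    rw [hr, Real.log_mul hq.ne' (Real.exp_pos _).ne', Real.log_exp]; ring
  have hb := one_add_mul_self_le_rpow_one_add (s := r * x - 1) (by nlinarith [mul_nonneg hr0.le hx])
    hα.le
  rw [show 1 + (r * x - 1) = r * x by ring, Real.mul_rpow hr0.le hx] at hb
  have hc : Real.exp (-(α - 1) * ε + (α - 1) * Real.log (1 - 1 / α) - Real.log α)
      = r ^ α * (Real.exp ε / (α - 1)) := by
    have e1 : r ^ α = Real.exp (α * (Real.log (1 - 1 / α) - ε)) := by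
      rw [Real.rpow_def_of_pos hr0, hrl, mul_comm]
    have e2 : Real.log (1 - 1 / α) = Real.log (α - 1) - Real.log α := by
      rw [h1α, Real.log_div hα1.ne' hα0.ne']
    have e3 : Real.exp ε / (α - 1) = Real.exp (ε - Real.log (α - 1)) := by
      rw [Real.exp_sub, Real.exp_log hα1]
    rw [e1, e3, ← Real.exp_add, e2]
    congr 1; ring
  rw [hc]
  have h3 : Real.exp ε / (α - 1) * (1 + α * (r * x - 1)) ≤
      Real.exp ε / (α - 1) * (r ^ α * x ^ α) := by gcongr
  have h4 : Real.exp ε / (α - 1) * (1 + α * (r * x - 1)) = x - Real.exp ε := by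
    rw [hr, h1α, Real.exp_neg]
    have := (Real.exp_pos ε).ne'
    field_simp
    ring
  rw [h4] at h3
  nlinarith [h3]

/-- Rényi privacy implies approximate privacy, with the loss `rdpToEps`. -/
theorem RenyiBound.measure_le {Ω : Type*} [MeasurableSpace Ω] {α τ ε δ : ℝ} {P Q : Measure Ω}
    (hα : 1 < α) (hδ : 0 < δ) (hε : rdpToEps α τ δ ≤ ε)
    (h : RenyiBound α (ENNReal.ofReal (Real.exp ((α - 1) * τ))) P Q) {S : Set Ω}
    (hS : MeasurableSet S) :
    P S ≤ ENNReal.ofReal (Real.exp ε) * Q S + ENNReal.ofReal δ := by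
  obtain ⟨f, hf, rfl, hB⟩ := h
  have hα0 : 0 < α - 1 := by linarith
  set c := Real.exp (-(α - 1) * ε + (α - 1) * Real.log (1 - 1 / α) - Real.log α) with hc
  have hc0 : 0 < c := Real.exp_pos _
  have hpt : ∀ y : ℝ≥0∞, y ≤ ENNReal.ofReal (Real.exp ε) + ENNReal.ofReal c * y ^ α := by
    intro y
    rcases eq_or_ne y ∞ with rfl | hy
    · rw [ENNReal.top_rpow_of_pos (by linarith), ENNReal.mul_top (by simpa using hc0)]
      simp
    · lift y to ℝ≥0 using hy
      rw [← ENNReal.ofReal_coe_nnreal, ENNReal.ofReal_rpow_of_nonneg y.coe_nonneg (by linarith),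
        ← ENNReal.ofReal_mul hc0.le, ← ENNReal.ofReal_add (Real.exp_pos _).le (by positivity)]
      exact ENNReal.ofReal_le_ofReal (le_exp_add_mul_rpow hα y.coe_nonneg)
  have hcδ : c * Real.exp ((α - 1) * τ) ≤ δ := by
    rw [hc, ← Real.exp_add, ← Real.le_log_iff_exp_le hδ]
    unfold rdpToEps at hε
    have h1 : Real.log (1 / δ) = - Real.log δ := by rw [one_div, Real.log_inv]
    rw [h1] at hε
    have h2 := mul_le_mul_of_nonneg_left hε hα0.le
    rw [mul_add, mul_div_cancel₀ _ hα0.ne'] at h2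
    linarith
  rw [withDensity_apply _ hS]
  calc ∫⁻ ω in S, f ω ∂Q
      ≤ ∫⁻ ω in S, (ENNReal.ofReal (Real.exp ε) + ENNReal.ofReal c * f ω ^ α) ∂Q :=
        lintegral_mono fun ω => hpt _
    _ = ENNReal.ofReal (Real.exp ε) * Q S + ENNReal.ofReal c * ∫⁻ ω in S, f ω ^ α ∂Q := by
        rw [lintegral_add_left measurable_const, lintegral_const_mul _ (hf.pow_const _)]
        simp
    _ ≤ ENNReal.ofReal (Real.exp ε) * Q S +
          ENNReal.ofReal c * ENNReal.ofReal (Real.exp ((α - 1) * τ)) := by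
        gcongr
        exact (setLIntegral_le_lintegral _ _).trans hB
    _ ≤ _ := by
        rw [← ENNReal.ofReal_mul hc0.le]
        gcongr

end LOCKS

namespace LOCKS

/-! ### Translates of Gaussian measures -/

/-- The density of a centred Gaussian of variance `v`, translated by `a`, with respect to the
centred Gaussian itself. -/
noncomputable def gaussTilt (v : ℝ≥0) (a x : ℝ) : ℝ≥0∞ :=
  ENNReal.ofReal (Real.exp ((a * x - a ^ 2 / 2) / v))

theorem measurable_gaussTilt (v : ℝ≥0) : Measurable fun q : ℝ × ℝ => gaussTilt v q.1 q.2 := by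
  unfold gaussTilt; fun_prop

theorem gaussianReal_map_add_eq_withDensity {v : ℝ≥0} (hv : v ≠ 0) (a : ℝ) :
    (gaussianReal 0 v).map (· + a) = (gaussianReal 0 v).withDensity (gaussTilt v a) := by
  have hm : Measurable (gaussTilt v a) := (measurable_gaussTilt v).comp measurable_prodMk_left
  rw [gaussianReal_map_add_const, gaussianReal_of_var_ne_zero _ hv,
    gaussianReal_of_var_ne_zero _ hv, ← withDensity_mul _ (measurable_gaussianPDF 0 v) hm]
  congr 1
  ext x
  have hv' : (v : ℝ) ≠ 0 := by exact_mod_cast hv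
  simp only [Pi.mul_apply, gaussianPDF, gaussTilt, gaussianPDFReal]
  rw [← ENNReal.ofReal_mul (by positivity), mul_assoc (√_)⁻¹,
    ← Real.exp_add (-(x - 0) ^ 2 / (2 * v))]
  congr 3
  field_simp
  ring

theorem lintegral_gaussTilt_rpow {v : ℝ≥0} (hv : v ≠ 0) {α : ℝ} (hα : 0 ≤ α) (a : ℝ) :
    ∫⁻ x, gaussTilt v a x ^ α ∂(gaussianReal 0 v) =
      ENNReal.ofReal (Real.exp (α * (α - 1) / 2 * (a ^ 2 / v))) := by
  have hv' : (v : ℝ) ≠ 0 := by exact_mod_cast hv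
  have h1 : ∀ x, gaussTilt v a x ^ α = ENNReal.ofReal (Real.exp (-(α * a ^ 2 / (2 * v)))) *
      ENNReal.ofReal (Real.exp (α * a / v * x)) := fun x => by
    rw [gaussTilt, ENNReal.ofReal_rpow_of_nonneg (Real.exp_pos _).le hα, ← Real.exp_mul,
      ← ENNReal.ofReal_mul (Real.exp_pos _).le, ← Real.exp_add]
    congr 2
    field_simp
    ring
  simp only [h1]
  rw [lintegral_const_mul _ (by fun_prop),
    ← ofReal_integral_eq_lintegral_ofReal (integrable_exp_mul_gaussianReal _)
      (ae_of_all _ fun x => (Real.exp_pos _).le)]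
  have h2 : ∫ x, Real.exp (α * a / v * x) ∂(gaussianReal 0 v) =
      Real.exp (0 * (α * a / v) + v * (α * a / v) ^ 2 / 2) :=
    congrFun (mgf_id_gaussianReal (μ := 0) (v := v)) (α * a / v)
  rw [h2, ← ENNReal.ofReal_mul (Real.exp_pos _).le, ← Real.exp_add]
  congr 2
  field_simp
  ring

theorem lintegral_pi_prod {ι : Type*} [Fintype ι] {X : ι → Type*} [∀ i, MeasurableSpace (X i)]
    (μ : ∀ i, Measure (X i)) [∀ i, IsProbabilityMeasure (μ i)] {f : ∀ i, X i → ℝ≥0∞}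
    (hf : ∀ i, Measurable (f i)) :
    ∫⁻ x, ∏ i, f i (x i) ∂(Measure.pi μ) = ∏ i, ∫⁻ y, f i y ∂(μ i) := by
  refine (lintegral_prod_eq_prod_lintegral_of_indepFun Finset.univ
    (fun i (x : ∀ i, X i) => f i (x i)) (iIndepFun_pi fun i => (hf i).aemeasurable)
    fun i => (hf i).comp (measurable_pi_apply i)).trans ?_
  exact Finset.prod_congr rfl fun i _ => (measurePreserving_eval μ i).lintegral_comp (hf i)

theorem pi_eq_withDensity_prod {ι : Type*} [Fintype ι] {X : ι → Type*}
    [∀ i, MeasurableSpace (X i)] (μ ν : ∀ i, Measure (X i)) [∀ i, IsProbabilityMeasure (μ i)]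
    [∀ i, SigmaFinite (ν i)] {f : ∀ i, X i → ℝ≥0∞} (hf : ∀ i, Measurable (f i))
    (hν : ∀ i, ν i = (μ i).withDensity (f i)) :
    Measure.pi ν = (Measure.pi μ).withDensity fun x => ∏ i, f i (x i) := by
  classical
  refine Measure.pi_eq fun s hs => ?_
  rw [withDensity_apply _ (.univ_pi hs), ← lintegral_indicator (.univ_pi hs)]
  have h1 : ∀ x : ∀ i, X i, (Set.univ.pi s).indicator (fun x => ∏ i, f i (x i)) x =
      ∏ i, (s i).indicator (f i) (x i) := fun x => by
    by_cases hx : x ∈ Set.univ.pi s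
    · rw [Set.indicator_of_mem hx]
      exact Finset.prod_congr rfl fun i _ => (Set.indicator_of_mem (hx i trivial) _).symm
    · rw [Set.indicator_of_notMem hx]
      simp only [Set.mem_univ_pi, not_forall] at hx
      obtain ⟨i, hi⟩ := hx
      exact (Finset.prod_eq_zero (Finset.mem_univ i) (Set.indicator_of_notMem hi _)).symm
  simp only [h1]
  rw [lintegral_pi_prod μ fun i => (hf i).indicator (hs i)]
  refine Finset.prod_congr rfl fun i _ => ?_
  rw [lintegral_indicator (hs i), hν, withDensity_apply _ (hs i)]

theorem pi_map_eq_withDensity_prod {ι : Type*} [Fintype ι] {X : ι → Type*}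
    [∀ i, MeasurableSpace (X i)] (μ : ∀ i, Measure (X i)) [∀ i, IsProbabilityMeasure (μ i)]
    {h : ∀ i, X i → X i} (hh : ∀ i, Measurable (h i)) {f : ∀ i, X i → ℝ≥0∞}
    (hf : ∀ i, Measurable (f i)) (hμ : ∀ i, (μ i).map (h i) = (μ i).withDensity (f i)) :
    (Measure.pi μ).map (fun x i => h i (x i)) =
      (Measure.pi μ).withDensity fun x => ∏ i, f i (x i) := by
  have : ∀ i, IsProbabilityMeasure ((μ i).map (h i)) := fun i =>
    Measure.isProbabilityMeasure_map (hh i).aemeasurable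
  rw [Measure.pi_map_pi fun i => (hh i).aemeasurable]
  exact pi_eq_withDensity_prod _ _ hf hμ

/-! ### Translates of the random draws of one round -/

section Products

-- The four factors are those of `Seed`, of which only the second and the fourth are translated.
variable {X Y Z W : Type*} [MeasurableSpace X] [MeasurableSpace Y] [MeasurableSpace Z]
  [MeasurableSpace W] (μ : Measure X) (ν : Measure Y) (ρ : Measure Z) (κ : Measure W)
  [IsProbabilityMeasure μ] [IsProbabilityMeasure ν] [IsProbabilityMeasure ρ]
  [IsProbabilityMeasure κ]

theorem prod_prod_prod_map_eq_withDensity {f : Y → Y} (hf : Measurable f) {g : W → W}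
    (hg : Measurable g) {F : Y → ℝ≥0∞} (hF : Measurable F) {G : W → ℝ≥0∞} (hG : Measurable G)
    (hν : ν.map f = ν.withDensity F) (hκ : κ.map g = κ.withDensity G) :
    (μ.prod (ν.prod (ρ.prod κ))).map (fun ξ => (ξ.1, f ξ.2.1, ξ.2.2.1, g ξ.2.2.2)) =
      (μ.prod (ν.prod (ρ.prod κ))).withDensity fun ξ => F ξ.2.1 * G ξ.2.2.2 := by
  have h3 : (ρ.prod κ).map (Prod.map id g) = (ρ.prod κ).withDensity fun ξ => G ξ.2 := by
    rw [← Measure.map_prod_map _ _ measurable_id hg, Measure.map_id, hκ,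
      prod_withDensity_right hG]
  have : SFinite (ν.withDensity F) := by rw [← hν]; infer_instance
  have h2 : (ν.prod (ρ.prod κ)).map (Prod.map f (Prod.map id g)) =
      (ν.prod (ρ.prod κ)).withDensity fun ξ => F ξ.1 * G ξ.2.2 := by
    rw [← Measure.map_prod_map _ _ hf (measurable_id.prodMap hg), h3, hν,
      prod_withDensity (g := fun ξ : Z × W => G ξ.2) hF (hG.comp measurable_snd)]
  have h1 : (fun ξ : X × Y × Z × W => (ξ.1, f ξ.2.1, ξ.2.2.1, g ξ.2.2.2)) =
      Prod.map id (Prod.map f (Prod.map id g)) := rfl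
  rw [h1, ← Measure.map_prod_map _ _ measurable_id (hf.prodMap (measurable_id.prodMap hg)), h2,
    Measure.map_id, prod_withDensity_right (g := fun ξ : Y × Z × W => F ξ.1 * G ξ.2.2)
      ((hF.comp measurable_fst).mul (hG.comp measurable_snd.snd))]

theorem lintegral_prod_prod_prod {F : Y → ℝ≥0∞} (hF : Measurable F) {G : W → ℝ≥0∞}
    (hG : Measurable G) :
    ∫⁻ ξ, F ξ.2.1 * G ξ.2.2.2 ∂(μ.prod (ν.prod (ρ.prod κ))) =
      (∫⁻ y, F y ∂ν) * ∫⁻ w, G w ∂κ := by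
  rw [measurePreserving_snd.lintegral_comp (f := fun y : Y × Z × W => F y.1 * G y.2.2)
      ((hF.comp measurable_fst).mul (hG.comp measurable_snd.snd)),
    lintegral_prod_mul (f := F) (g := fun y : Z × W => G y.2)
      hF.aemeasurable (hG.comp measurable_snd).aemeasurable,
    measurePreserving_snd.lintegral_comp hG]

end Products

variable {n p : ℕ} {𝒳 : Type*} {Kmin Kmax : ℕ}

/-- Translation of the noise of the norms by `a` and of the noise of the gradients by `c`. -/
def shiftSeed (a : Fin n → ℝ) (c : Fin n → Fin p → ℝ) (ξ : Seed n p) : Seed n p :=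
  (ξ.1, fun i => ξ.2.1 i + a i, ξ.2.2.1, fun i j => ξ.2.2.2 i j + c i j)

/-- The density of the translated draws with respect to the original ones. -/
noncomputable def seedTilt (vs v0 : ℝ≥0) (a : Fin n → ℝ) (c : Fin n → Fin p → ℝ)
    (ξ : Seed n p) : ℝ≥0∞ :=
  (∏ i, gaussTilt vs (a i) (ξ.2.1 i)) * ∏ i, ∏ j, gaussTilt v0 (c i j) (ξ.2.2.2 i j)

theorem measurable_shiftSeed : Measurable fun q :
    ((Fin n → ℝ) × (Fin n → Fin p → ℝ)) × Seed n p => shiftSeed q.1.1 q.1.2 q.2 := by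
  unfold shiftSeed
  have hv : Measurable fun q : ((Fin n → ℝ) × (Fin n → Fin p → ℝ)) × Seed n p =>
      fun i => q.2.2.1 i + q.1.1 i := by fun_prop
  have hu : Measurable fun q : ((Fin n → ℝ) × (Fin n → Fin p → ℝ)) × Seed n p =>
      fun i j => q.2.2.2.2 i j + q.1.2 i j := by fun_prop
  exact measurable_snd.fst.prodMk (hv.prodMk (measurable_snd.snd.snd.fst.prodMk hu))

theorem measurable_seedTilt (vs v0 : ℝ≥0) : Measurable fun q :
    ((Fin n → ℝ) × (Fin n → Fin p → ℝ)) × Seed n p => seedTilt vs v0 q.1.1 q.1.2 q.2 := by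
  unfold seedTilt
  have hv : ∀ i, Measurable fun q : ((Fin n → ℝ) × (Fin n → Fin p → ℝ)) × Seed n p =>
      gaussTilt vs (q.1.1 i) (q.2.2.1 i) := fun i => by unfold gaussTilt; fun_prop
  have hu : ∀ i j, Measurable fun q : ((Fin n → ℝ) × (Fin n → Fin p → ℝ)) × Seed n p =>
      gaussTilt v0 (q.1.2 i j) (q.2.2.2.2 i j) := fun i j => by unfold gaussTilt; fun_prop
  exact (Finset.measurable_fun_prod _ fun i _ => hv i).mul
    (Finset.measurable_fun_prod _ fun i _ => Finset.measurable_fun_prod _ fun j _ => hu i j)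

namespace Config

theorem seedLaw_map_shiftSeed (A : Config n p 𝒳) (hσs : 0 < A.σs) (hσ0 : 0 < A.σ0)
    (a : Fin n → ℝ) (c : Fin n → Fin p → ℝ) :
    A.seedLaw.map (shiftSeed a c) =
      A.seedLaw.withDensity (seedTilt (A.σs ^ 2) (A.σ0 ^ 2) a c) := by
  have hs : A.σs ^ 2 ≠ 0 := by positivity
  have h0 : A.σ0 ^ 2 ≠ 0 := by positivity
  have hm : ∀ v b, Measurable (gaussTilt v b) := fun v b =>
    (measurable_gaussTilt v).comp measurable_prodMk_left
  have hadd : ∀ b : ℝ, Measurable fun x : ℝ => x + b := fun b => measurable_id.add_const b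
  have hd2 : ∀ i, Measurable fun x : Fin p → ℝ => ∏ j, gaussTilt (A.σ0 ^ 2) (c i j) (x j) :=
    fun i => Finset.measurable_fun_prod _ fun j _ => (hm _ _).comp (measurable_pi_apply j)
  have hs2 : ∀ i, Measurable fun (x : Fin p → ℝ) j => x j + c i j := fun i =>
    measurable_pi_lambda _ fun j => (hadd _).comp (measurable_pi_apply j)
  refine prod_prod_prod_map_eq_withDensity _ _ _ _
    (f := fun (x : Fin n → ℝ) i => x i + a i)
    (g := fun (x : Fin n → Fin p → ℝ) i j => x i j + c i j)
    (F := fun x => ∏ i, gaussTilt (A.σs ^ 2) (a i) (x i))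
    (G := fun x => ∏ i, ∏ j, gaussTilt (A.σ0 ^ 2) (c i j) (x i j))
    (measurable_pi_lambda _ fun i => (hadd _).comp (measurable_pi_apply i))
    (measurable_pi_lambda _ fun i => (hs2 i).comp (measurable_pi_apply i))
    (Finset.measurable_fun_prod _ fun i _ => (hm _ _).comp (measurable_pi_apply i))
    (Finset.measurable_fun_prod _ fun i _ => (hd2 i).comp (measurable_pi_apply i)) ?_ ?_
  · exact pi_map_eq_withDensity_prod _ (h := fun i x => x + a i) (fun i => hadd _)
      (fun i => hm _ _) fun i => gaussianReal_map_add_eq_withDensity hs _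
  · have h1 : ∀ i, (Measure.pi fun _ : Fin p => gaussianReal 0 (A.σ0 ^ 2)).map
        (fun x j => x j + c i j) = (Measure.pi fun _ => gaussianReal 0 (A.σ0 ^ 2)).withDensity
          fun x => ∏ j, gaussTilt (A.σ0 ^ 2) (c i j) (x j) := fun i =>
      pi_map_eq_withDensity_prod (fun _ => gaussianReal 0 (A.σ0 ^ 2)) (h := fun j x => x + c i j)
        (fun j => hadd _) (fun j => hm _ _) fun j => gaussianReal_map_add_eq_withDensity h0 _
    exact pi_map_eq_withDensity_prod (fun _ => Measure.pi fun _ => gaussianReal 0 (A.σ0 ^ 2))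
      (h := fun i (x : Fin p → ℝ) j => x j + c i j)
      (f := fun i x => ∏ j, gaussTilt (A.σ0 ^ 2) (c i j) (x j)) hs2 hd2 h1

theorem lintegral_seedTilt_rpow (A : Config n p 𝒳) (hσs : 0 < A.σs) (hσ0 : 0 < A.σ0) {α : ℝ}
    (hα : 0 ≤ α) (a : Fin n → ℝ) (c : Fin n → Fin p → ℝ) :
    ∫⁻ ξ, seedTilt (A.σs ^ 2) (A.σ0 ^ 2) a c ξ ^ α ∂A.seedLaw =
      ENNReal.ofReal (Real.exp (α * (α - 1) / 2 *
        ((∑ i, a i ^ 2) / A.σs ^ 2 + (∑ i, ∑ j, c i j ^ 2) / A.σ0 ^ 2))) := by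
  have hs : A.σs ^ 2 ≠ 0 := by positivity
  have h0 : A.σ0 ^ 2 ≠ 0 := by positivity
  have hm : ∀ v b, Measurable fun x => gaussTilt v b x ^ α := fun v b =>
    ((measurable_gaussTilt v).comp measurable_prodMk_left).pow_const _
  have hd2 : ∀ i, Measurable fun x : Fin p → ℝ =>
      ∏ j, gaussTilt (A.σ0 ^ 2) (c i j) (x j) ^ α := fun i =>
    Finset.measurable_fun_prod _ fun j _ => (hm _ _).comp (measurable_pi_apply j)
  have h1 : ∀ ξ : Seed n p, seedTilt (A.σs ^ 2) (A.σ0 ^ 2) a c ξ ^ α =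
      (∏ i, gaussTilt (A.σs ^ 2) (a i) (ξ.2.1 i) ^ α) *
        ∏ i, ∏ j, gaussTilt (A.σ0 ^ 2) (c i j) (ξ.2.2.2 i j) ^ α := fun ξ => by
    simp only [seedTilt, ENNReal.mul_rpow_of_nonneg _ _ hα, ENNReal.prod_rpow_of_nonneg hα]
  simp only [h1]
  refine (lintegral_prod_prod_prod _ _ _ _
    (F := fun x : Fin n → ℝ => ∏ i, gaussTilt (A.σs ^ 2) (a i) (x i) ^ α)
    (G := fun x : Fin n → Fin p → ℝ => ∏ i, ∏ j, gaussTilt (A.σ0 ^ 2) (c i j) (x i j) ^ α)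
    (Finset.measurable_fun_prod _ fun i _ => (hm _ _).comp (measurable_pi_apply i))
    (Finset.measurable_fun_prod _ fun i _ => (hd2 i).comp (measurable_pi_apply i))).trans ?_
  rw [lintegral_pi_prod _ fun i => hm _ (a i)]
  rw [lintegral_pi_prod (f := fun i (x : Fin p → ℝ) =>
    ∏ j, gaussTilt (A.σ0 ^ 2) (c i j) (x j) ^ α) _ hd2]
  have h2 : ∀ i, ∫⁻ x : Fin p → ℝ, ∏ j, gaussTilt (A.σ0 ^ 2) (c i j) (x j) ^ α
      ∂(Measure.pi fun _ => gaussianReal 0 (A.σ0 ^ 2)) =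
      ∏ j, ENNReal.ofReal (Real.exp (α * (α - 1) / 2 * (c i j ^ 2 / A.σ0 ^ 2))) := fun i => by
    rw [lintegral_pi_prod _ fun j => hm _ (c i j)]
    simp only [lintegral_gaussTilt_rpow h0 hα, NNReal.coe_pow]
  simp only [h2, lintegral_gaussTilt_rpow hs hα, NNReal.coe_pow]
  have h3 : ∀ {m : ℕ} (y : Fin m → ℝ), ∏ i, ENNReal.ofReal (Real.exp (y i)) =
      ENNReal.ofReal (Real.exp (∑ i, y i)) := fun y => by
    rw [← ENNReal.ofReal_prod_of_nonneg fun _ _ => (Real.exp_pos _).le, ← Real.exp_sum]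
  simp only [h3]
  rw [← ENNReal.ofReal_mul (Real.exp_pos _).le, ← Real.exp_add]
  simp only [← Finset.mul_sum, ← Finset.sum_div, ← mul_add]

end Config

end LOCKS

namespace LOCKS

variable {n p : ℕ} {𝒳 : Type*} {Kmin Kmax : ℕ}

theorem norm_clip_le {C : ℝ} (hC : 0 < C) (g : Param p) : ‖clip C g‖ ≤ C := by
  have h1 : 0 < max 1 (‖g‖ / C) := lt_max_of_lt_left one_pos
  rw [clip, norm_smul, norm_inv, Real.norm_of_nonneg h1.le, inv_mul_le_iff₀ h1, mul_comm]
  calc ‖g‖ = C * (‖g‖ / C) := by field_simp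
    _ ≤ C * max 1 (‖g‖ / C) := by gcongr; exact le_max_right _ _

/-! ### Rényi divergence of the transcripts -/

namespace Config

theorem norm_clippedGrad_le (A : Config n p 𝒳) (hC : 0 < A.C) (i : Fin n)
    (D : LocalData 𝒳 Kmin Kmax) (w : Param p) : ‖A.clippedGrad i D w‖ ≤ A.C :=
  norm_clip_le hC _

/-- The differences of the norms of the clipped gradients for two datasets. -/
noncomputable def normShift (A : Config n p 𝒳) (D D' : Fin n → LocalData 𝒳 Kmin Kmax)
    (w : Param p) (i : Fin n) : ℝ :=
  ‖A.clippedGrad i (D i) w‖ - ‖A.clippedGrad i (D' i) w‖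

/-- The differences of the clipped gradients for two datasets. -/
noncomputable def gradShift (A : Config n p 𝒳) (D D' : Fin n → LocalData 𝒳 Kmin Kmax)
    (w : Param p) (i : Fin n) (j : Fin p) : ℝ :=
  (A.clippedGrad i (D i) w - A.clippedGrad i (D' i) w) j

/-- A change of the dataset is the same as a translation of the noise: both sampling stages see
the dataset only through the noisy norms, which the translation keeps fixed. -/
theorem message_eq_message_shiftSeed (A : Config n p 𝒳) (D D' : Fin n → LocalData 𝒳 Kmin Kmax)
    (w : Param p) (ξ : Seed n p) :
    A.message D w ξ =
      A.message D' w (shiftSeed (A.normShift D D' w) (A.gradShift D D' w) ξ) := by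
  have hz : A.noisyNorms D w (A.first ξ.1) ξ.2.1 =
      A.noisyNorms D' w (A.first ξ.1) fun i => ξ.2.1 i + A.normShift D D' w i := by
    funext i
    simp only [noisyNorms, normShift]
    split_ifs
    · ring
    · rfl
  have hg : ∀ Z, A.noisyGrads D w Z ξ.2.2.2 =
      A.noisyGrads D' w Z fun i j => ξ.2.2.2 i j + A.gradShift D D' w i j := by
    intro Z
    funext i
    simp only [noisyGrads, gradShift]
    split_ifs
    · ext j
      simp only [PiLp.add_apply, PiLp.sub_apply]
      ring
    · rfl
  simp only [message, shiftSeed, hz, hg]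

theorem step_eq_step_shiftSeed (A : Config n p 𝒳) (D D' : Fin n → LocalData 𝒳 Kmin Kmax) (t : ℕ)
    (s : (Fin t → Message n p) × Param p) (ξ : Seed n p) :
    A.step D t (s, ξ) =
      A.step D' t (s, shiftSeed (A.normShift D D' s.2) (A.gradShift D D' s.2) ξ) := by
  simp only [step, ← message_eq_message_shiftSeed]

theorem measurable_normShift (A : Config n p 𝒳) (D D' : Fin n → LocalData 𝒳 Kmin Kmax) :
    Measurable (A.normShift D D') :=
  measurable_pi_lambda _ fun i =>
    (A.measurable_clippedGrad i (D i)).norm.sub (A.measurable_clippedGrad i (D' i)).norm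

theorem measurable_gradShift (A : Config n p 𝒳) (D D' : Fin n → LocalData 𝒳 Kmin Kmax) :
    Measurable (A.gradShift D D') :=
  measurable_pi_lambda _ fun i => measurable_pi_lambda _ fun j =>
    (EuclideanSpace.proj j : Param p →L[ℝ] ℝ).continuous.measurable.comp
      ((A.measurable_clippedGrad i (D i)).sub (A.measurable_clippedGrad i (D' i)))

theorem sum_normShift_sq_le (A : Config n p 𝒳) (hC : 0 < A.C)
    {D D' : Fin n → LocalData 𝒳 Kmin Kmax} (h : Neighbor D D') (w : Param p) :
    ∑ i, A.normShift D D' w i ^ 2 ≤ A.C ^ 2 := by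
  obtain ⟨i, hi⟩ := h
  rw [Finset.sum_eq_single i (fun j _ hj => by simp [normShift, hi j hj]) (by simp)]
  have h1 := A.norm_clippedGrad_le hC i (D i) w
  have h2 := A.norm_clippedGrad_le hC i (D' i) w
  have h3 := norm_nonneg (A.clippedGrad i (D i) w)
  have h4 := norm_nonneg (A.clippedGrad i (D' i) w)
  exact sq_le_sq' (by unfold normShift; linarith) (by unfold normShift; linarith)

theorem sum_gradShift_sq_le (A : Config n p 𝒳) (hC : 0 < A.C)
    {D D' : Fin n → LocalData 𝒳 Kmin Kmax} (h : Neighbor D D') (w : Param p) :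
    ∑ i, ∑ j, A.gradShift D D' w i j ^ 2 ≤ (2 * A.C) ^ 2 := by
  obtain ⟨i, hi⟩ := h
  rw [Finset.sum_eq_single i (fun j _ hj => by simp [gradShift, hi j hj]) (by simp)]
  have h1 := A.norm_clippedGrad_le hC i (D i) w
  have h2 := A.norm_clippedGrad_le hC i (D' i) w
  have h3 := norm_sub_le (A.clippedGrad i (D i) w) (A.clippedGrad i (D' i) w)
  have h4 : ∑ j, A.gradShift D D' w i j ^ 2 =
      ‖A.clippedGrad i (D i) w - A.clippedGrad i (D' i) w‖ ^ 2 := by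
    simp only [EuclideanSpace.real_norm_sq_eq, gradShift]
  rw [h4]
  exact pow_le_pow_left₀ (norm_nonneg _) (by linarith) 2

theorem lintegral_seedTilt_le (A : Config n p 𝒳) (hC : 0 < A.C) (hσs : 0 < A.σs)
    (hσ0 : 0 < A.σ0) {α : ℝ} (hα : 1 < α) {D D' : Fin n → LocalData 𝒳 Kmin Kmax}
    (h : Neighbor D D') (w : Param p) :
    ∫⁻ ξ, seedTilt (A.σs ^ 2) (A.σ0 ^ 2) (A.normShift D D' w) (A.gradShift D D' w) ξ ^ α
        ∂A.seedLaw ≤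
      ENNReal.ofReal (Real.exp ((α - 1) * (normCost A.C A.σs α + gradCost A.C A.σ0 α))) := by
  rw [A.lintegral_seedTilt_rpow hσs hσ0 (by linarith)]
  refine ENNReal.ofReal_le_ofReal (Real.exp_le_exp.2 ?_)
  have hs : (0 : ℝ) < A.σs := hσs
  have h0 : (0 : ℝ) < A.σ0 := hσ0
  have hα1 : 0 < α - 1 := by linarith
  calc α * (α - 1) / 2 * ((∑ i, A.normShift D D' w i ^ 2) / (A.σs : ℝ) ^ 2 +
        (∑ i, ∑ j, A.gradShift D D' w i j ^ 2) / (A.σ0 : ℝ) ^ 2)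
      ≤ α * (α - 1) / 2 * (A.C ^ 2 / (A.σs : ℝ) ^ 2 + (2 * A.C) ^ 2 / (A.σ0 : ℝ) ^ 2) := by
        gcongr
        · exact A.sum_normShift_sq_le hC h w
        · exact A.sum_gradShift_sq_le hC h w
    _ = _ := by
        unfold normCost gradCost gaussCost
        field_simp

theorem renyiBound_view (A : Config n p 𝒳) (hC : 0 < A.C) (hσs : 0 < A.σs)
    (hσ0 : 0 < A.σ0) {α : ℝ} (hα : 1 < α) {D D' : Fin n → LocalData 𝒳 Kmin Kmax}
    (h : Neighbor D D') (t : ℕ) :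
    RenyiBound α (ENNReal.ofReal (Real.exp ((α - 1) * totalCost t A.C A.σs A.σ0 α)))
      (A.view t D) (A.view t D') := by
  induction t with
  | zero => simpa [totalCost, view] using RenyiBound.refl
  | succ t ih =>
    set ψ : (Fin t → Message n p) × Param p → Seed n p → Seed n p := fun s =>
      shiftSeed (A.normShift D D' s.2) (A.gradShift D D' s.2) with hψdef
    set g : (Fin t → Message n p) × Param p → Seed n p → ℝ≥0∞ := fun s =>
      seedTilt (A.σs ^ 2) (A.σ0 ^ 2) (A.normShift D D' s.2) (A.gradShift D D' s.2) with hgdef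
    have hshift : Measurable fun q : ((Fin t → Message n p) × Param p) × Seed n p =>
        ((A.normShift D D' q.1.2, A.gradShift D D' q.1.2), q.2) :=
      (((A.measurable_normShift D D').comp measurable_fst.snd).prodMk
        ((A.measurable_gradShift D D').comp measurable_fst.snd)).prodMk measurable_snd
    have hψ : Measurable (Function.uncurry ψ) :=
      ((measurable_shiftSeed (n := n) (p := p)).comp hshift :)
    have hg : Measurable (Function.uncurry g) :=
      ((measurable_seedTilt (n := n) (p := p) (A.σs ^ 2) (A.σ0 ^ 2)).comp hshift :)
    have hν : ∀ s, A.seedLaw.map (ψ s) = A.seedLaw.withDensity (g s) := fun s =>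
      A.seedLaw_map_shiftSeed hσs hσ0 _ _
    have hI : ∀ s, ∫⁻ ξ, g s ξ ^ α ∂A.seedLaw ≤ ENNReal.ofReal
        (Real.exp ((α - 1) * (normCost A.C A.σs α + gradCost A.C A.σ0 α))) := fun s =>
      A.lintegral_seedTilt_le hC hσs hσ0 hα h s.2
    have hprod := ih.prod_shift (by linarith) hψ hg hν hI
    have hm : Measurable fun q : ((Fin t → Message n p) × Param p) × Seed n p =>
        (q.1, ψ q.1 q.2) := measurable_fst.prodMk hψ
    have := Measure.isProbabilityMeasure_map (μ := (A.view t D).prod A.seedLaw) hm.aemeasurable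
    have hmap := hprod.map hα (A.measurable_step D' t)
    rw [Measure.map_map (A.measurable_step D' t) hm] at hmap
    have hstep : A.step D t = A.step D' t ∘ fun q : ((Fin t → Message n p) × Param p) × Seed n p =>
        (q.1, ψ q.1 q.2) :=
      funext fun q => A.step_eq_step_shiftSeed D D' t q.1 q.2
    rw [← ENNReal.ofReal_mul (Real.exp_pos _).le, ← Real.exp_add, ← mul_add] at hmap
    have hcost : totalCost (t + 1) A.C A.σs A.σ0 α = totalCost t A.C A.σs A.σ0 α +
        (normCost A.C A.σs α + gradCost A.C A.σ0 α) := by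
      unfold totalCost; push_cast; ring
    rw [hcost, view, view, hstep]
    exact hmap

theorem renyiBound_output (A : Config n p 𝒳) (hC : 0 < A.C) (hσs : 0 < A.σs)
    (hσ0 : 0 < A.σ0) {α : ℝ} (hα : 1 < α) {D D' : Fin n → LocalData 𝒳 Kmin Kmax}
    (h : Neighbor D D') (t : ℕ) :
    RenyiBound α (ENNReal.ofReal (Real.exp ((α - 1) * totalCost t A.C A.σs A.σ0 α)))
      (A.output t D) (A.output t D') :=
  (A.renyiBound_view hC hσs hσ0 hα h t).map hα measurable_snd

/-! ### Expected charge of a round -/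

theorem volume_pi_unitInterval_lt_le (i : Fin n) (x : ℝ) :
    (volume : Measure (Fin n → unitInterval)) {U | (U i : ℝ) < x} ≤ ENNReal.ofReal x := by
  have hm : MeasurableSet {u : unitInterval | (u : ℝ) < x} :=
    measurableSet_lt measurable_subtype_coe measurable_const
  have h1 := (measurePreserving_eval (fun _ : Fin n => (volume : Measure unitInterval))
    i).measure_preimage hm.nullMeasurableSet
  refine h1.trans_le ?_
  rw [unitInterval.volume_apply]
  calc volume (Subtype.val '' {u : unitInterval | (u : ℝ) < x})
      ≤ volume (Set.Ico 0 x) := by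
        refine measure_mono ?_
        rintro _ ⟨u, hu, rfl⟩
        exact ⟨u.2.1, hu⟩
    _ = ENNReal.ofReal x := by simp

theorem measurable_roundCharge (C : ℝ) (σs σ0 : ℝ≥0) (α : ℝ) :
    Measurable fun r : Message n p => ENNReal.ofReal (roundCharge C σs σ0 α r) := by
  unfold roundCharge
  have h : Measurable fun X : Fin n → Bool =>
      ((Finset.univ.filter fun i => X i = true).card : ℝ) := measurable_of_finite _
  exact (((h.comp measurable_fst).mul_const _).add
    ((h.comp measurable_snd.snd.fst).mul_const _)).ennreal_ofReal

theorem weight_le_one (A : Config n p 𝒳) (X : Fin n → Bool) (z : Fin n → ℝ) (j : Fin n) :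
    A.weight X z j ≤ 1 := min_le_left _ _

theorem seedLaw_first_le (A : Config n p 𝒳) (i : Fin n) :
    A.seedLaw {ξ | A.first ξ.1 i = true} ≤ ENNReal.ofReal ((A.m : ℝ) / n) := by
  have h : {ξ : Seed n p | A.first ξ.1 i = true} =
      {U : Fin n → unitInterval | (U i : ℝ) < (A.m : ℝ) / n} ×ˢ Set.univ := by
    ext ξ; simp [first]
  unfold seedLaw
  rw [h, Measure.prod_prod, measure_univ, mul_one]
  exact volume_pi_unitInterval_lt_le i _

/-- As `p_j ≤ 1`, a client of the first sample is kept with probability at most `1 / k`. -/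
theorem seedLaw_second_le (A : Config n p 𝒳) (D : Fin n → LocalData 𝒳 Kmin Kmax) (w : Param p)
    (i : Fin n) :
    A.seedLaw {ξ | (A.message D w ξ).2.2.1 i = true} ≤
      ENNReal.ofReal ((A.m : ℝ) / n * (1 / A.k)) := by
  have h : {ξ : Seed n p | (A.message D w ξ).2.2.1 i = true} ⊆
      {U : Fin n → unitInterval | (U i : ℝ) < (A.m : ℝ) / n} ×ˢ (Set.univ ×ˢ
        ({U : Fin n → unitInterval | (U i : ℝ) < 1 / A.k} ×ˢ Set.univ)) := by
    intro ξ hξ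
    simp only [message, second, first, Set.mem_ofPred_eq, Bool.and_eq_true,
      decide_eq_true_eq] at hξ
    refine ⟨hξ.1, trivial, hξ.2.trans_le ?_, trivial⟩
    gcongr
    exact A.weight_le_one _ _ _
  refine (measure_mono h).trans ?_
  unfold seedLaw
  rw [Measure.prod_prod, Measure.prod_prod, Measure.prod_prod, measure_univ, measure_univ,
    mul_one, one_mul, ENNReal.ofReal_mul (by positivity)]
  exact mul_le_mul' (volume_pi_unitInterval_lt_le i _) (volume_pi_unitInterval_lt_le i _)

theorem lintegral_roundCharge_message_le (A : Config n p 𝒳) {α : ℝ} (hα : 0 ≤ α)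
    (hn : n ≠ 0) (D : Fin n → LocalData 𝒳 Kmin Kmax) (w : Param p) :
    ∫⁻ ξ, ENNReal.ofReal (roundCharge A.C A.σs A.σ0 α (A.message D w ξ)) ∂A.seedLaw ≤
      ENNReal.ofReal ((A.m : ℝ) * normCost A.C A.σs α +
          batch A.m A.k * gradCost A.C A.σ0 α) := by
  have hcs : 0 ≤ normCost A.C A.σs α := by unfold normCost gaussCost; positivity
  have hc0 : 0 ≤ gradCost A.C A.σ0 α := by unfold gradCost gaussCost; positivity
  have hmsg : Measurable (A.message D w) := (A.measurable_message D).comp measurable_prodMk_left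
  have hX : ∀ i, MeasurableSet {ξ : Seed n p | A.first ξ.1 i = true} := fun i =>
    measurableSet_eq_fun ((measurable_pi_apply i).comp hmsg.fst) measurable_const
  have hZ : ∀ i, MeasurableSet {ξ : Seed n p | (A.message D w ξ).2.2.1 i = true} := fun i =>
    measurableSet_eq_fun ((measurable_pi_apply i).comp hmsg.snd.snd.fst) measurable_const
  have hpt : ∀ ξ, ENNReal.ofReal (roundCharge A.C A.σs A.σ0 α (A.message D w ξ)) =
      (∑ i, {ξ : Seed n p | A.first ξ.1 i = true}.indicator 1 ξ) *
          ENNReal.ofReal (normCost A.C A.σs α) +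
        (∑ i, {ξ : Seed n p | (A.message D w ξ).2.2.1 i = true}.indicator 1 ξ) *
          ENNReal.ofReal (gradCost A.C A.σ0 α) := by
    intro ξ
    rw [roundCharge, ENNReal.ofReal_add (by positivity) (by positivity),
      ENNReal.ofReal_mul (by positivity), ENNReal.ofReal_mul (by positivity),
      ENNReal.ofReal_natCast, ENNReal.ofReal_natCast]
    simp only [Set.indicator_apply, Set.mem_ofPred_eq, Pi.one_apply, Finset.sum_boole]
    rfl
  simp only [hpt]
  have hiX : ∀ i, Measurable fun ξ : Seed n p =>
      ({ξ : Seed n p | A.first ξ.1 i = true}.indicator 1 ξ : ℝ≥0∞) := fun i =>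
    measurable_one.indicator (hX i)
  have hiZ : ∀ i, Measurable fun ξ : Seed n p =>
      ({ξ : Seed n p | (A.message D w ξ).2.2.1 i = true}.indicator 1 ξ : ℝ≥0∞) := fun i =>
    measurable_one.indicator (hZ i)
  rw [lintegral_add_left ((Finset.measurable_fun_sum _ fun i _ => hiX i).mul_const _),
    lintegral_mul_const _ (Finset.measurable_fun_sum _ fun i _ => hiX i),
    lintegral_mul_const _ (Finset.measurable_fun_sum _ fun i _ => hiZ i),
    lintegral_finsetSum _ fun i _ => hiX i, lintegral_finsetSum _ fun i _ => hiZ i]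
  simp only [lintegral_indicator_one (hX _), lintegral_indicator_one (hZ _)]
  have hn' : (n : ℝ) ≠ 0 := by exact_mod_cast hn
  have hsum : ∀ x : ℝ, 0 ≤ x → ∑ _i : Fin n, ENNReal.ofReal (x / n) = ENNReal.ofReal x := by
    intro x hx
    rw [← ENNReal.ofReal_sum_of_nonneg fun _ _ => by positivity]
    simp [mul_div_cancel₀ _ hn']
  rw [ENNReal.ofReal_add (mul_nonneg (by positivity) hcs)
    (mul_nonneg (by unfold batch; positivity) hc0), ENNReal.ofReal_mul (by positivity),
    ENNReal.ofReal_mul (by unfold batch; positivity)]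
  gcongr
  · rw [← hsum _ (Nat.cast_nonneg A.m)]
    exact Finset.sum_le_sum fun i _ => A.seedLaw_first_le i
  · rw [← hsum (batch A.m A.k) (by unfold batch; positivity)]
    refine Finset.sum_le_sum fun i _ => (A.seedLaw_second_le D w i).trans_eq ?_
    congr 1
    unfold batch
    ring

theorem lintegral_roundCharge_view_le (A : Config n p 𝒳) {α : ℝ} (hα : 0 ≤ α)
    (hn : n ≠ 0) (D : Fin n → LocalData 𝒳 Kmin Kmax) (T : ℕ) (t : Fin T) :
    ∫⁻ s, ENNReal.ofReal (roundCharge A.C A.σs A.σ0 α (s.1 t)) ∂(A.view T D) ≤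
      ENNReal.ofReal ((A.m : ℝ) * normCost A.C A.σs α +
          batch A.m A.k * gradCost A.C A.σ0 α) := by
  have hc := measurable_roundCharge (n := n) (p := p) A.C A.σs A.σ0 α
  induction T with
  | zero => exact t.elim0
  | succ T ih =>
    have hs : Measurable fun s : (Fin (T + 1) → Message n p) × Param p =>
        ENNReal.ofReal (roundCharge A.C A.σs A.σ0 α (s.1 t)) :=
      hc.comp ((measurable_pi_apply t).comp measurable_fst)
    rw [view, lintegral_map hs (A.measurable_step D T)]
    induction t using Fin.lastCases with
    | last =>
      have hw : Measurable fun q : ((Fin T → Message n p) × Param p) × Seed n p => q.1.2 :=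
        measurable_fst.snd
      have hF : Measurable fun q : ((Fin T → Message n p) × Param p) × Seed n p =>
          ENNReal.ofReal (roundCharge A.C A.σs A.σ0 α (A.message D q.1.2 q.2)) :=
        (hc.comp ((A.measurable_message D).comp (hw.prodMk measurable_snd)) :)
      simp only [step, Fin.snoc_last]
      rw [lintegral_prod _ hF.aemeasurable]
      have hle := fun s : (Fin T → Message n p) × Param p =>
        A.lintegral_roundCharge_message_le hα hn D s.2
      exact (lintegral_mono hle).trans_eq (by rw [lintegral_const, measure_univ, mul_one])
    | cast t =>
      have hF : Measurable fun s : (Fin T → Message n p) × Param p =>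
          ENNReal.ofReal (roundCharge A.C A.σs A.σ0 α (s.1 t)) :=
        hc.comp ((measurable_pi_apply t).comp measurable_fst)
      simp only [step, Fin.snoc_castSucc]
      exact (measurePreserving_fst.lintegral_comp hF).trans_le (ih t)

end Config

end LOCKS

namespace LOCKS

/-! ### Calibration of the noise -/

theorem rdpToEps_le_add_log_div {α τ δ : ℝ} (hα : 1 < α) :
    rdpToEps α τ δ ≤ τ + Real.log (1 / δ) / (α - 1) := by
  have hα0 : 0 < α - 1 := by linarith
  have h1 : Real.log (1 - 1 / α) ≤ 0 := by
    refine Real.log_nonpos ?_ ?_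
    · rw [sub_nonneg, div_le_one (by linarith)]; exact hα.le
    · have : 0 < 1 / α := by positivity
      linarith
  have h2 : 0 ≤ Real.log α := Real.log_nonneg hα.le
  unfold rdpToEps
  gcongr
  nlinarith [mul_nonneg hα0.le (neg_nonneg.2 h1)]

theorem totalCost_eq (T : ℕ) (C : ℝ) (σs σ0 : ℝ≥0) (α : ℝ) :
    totalCost T C σs σ0 α =
      α * ((T : ℝ) * (C ^ 2 / (2 * (σs : ℝ) ^ 2) + 4 * (C ^ 2 / (2 * (σ0 : ℝ) ^ 2)))) := by
  unfold totalCost normCost gradCost gaussCost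
  ring

theorem exists_rdpToEps_le (T : ℕ) {C : ℝ} (hC : 0 < C) {ε δ : ℝ} (hε : 0 < ε) (hδ : 0 < δ)
    (hδ1 : δ < 1) :
    ∃ α : ℝ, 1 < α ∧ ∃ σ : ℝ≥0, 0 < σ ∧ ∀ σs σ0 : ℝ≥0, σ ≤ σs → σ ≤ σ0 →
      rdpToEps α (totalCost T C σs σ0 α) δ ≤ ε := by
  have hl : 0 < Real.log (1 / δ) := Real.log_pos (by rw [lt_div_iff₀ hδ]; linarith)
  set β := 2 * Real.log (1 / δ) / ε with hβ
  have hβ0 : 0 < β := by positivity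
  set y := 5 * (1 + β) * (T + 1) * C ^ 2 / ε with hy
  have hy0 : 0 < y := by positivity
  refine ⟨1 + β, by linarith, (Real.sqrt y).toNNReal, by simpa using hy0, ?_⟩
  intro σs σ0 hs h0
  have hsq : ∀ σ : ℝ≥0, (Real.sqrt y).toNNReal ≤ σ → C ^ 2 / (2 * (σ : ℝ) ^ 2) ≤
      C ^ 2 / (2 * y) := by
    intro σ hσ
    have h1 : Real.sqrt y ≤ σ := Real.toNNReal_le_iff_le_coe.1 hσ
    have h2 : y ≤ (σ : ℝ) ^ 2 := (Real.sqrt_le_left σ.coe_nonneg).1 h1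
    gcongr
  refine (rdpToEps_le_add_log_div (by linarith)).trans ?_
  have h1 : totalCost T C σs σ0 (1 + β) ≤ ε / 2 := by
    rw [totalCost_eq]
    calc (1 + β) * ((T : ℝ) * (C ^ 2 / (2 * (σs : ℝ) ^ 2) + 4 * (C ^ 2 / (2 * (σ0 : ℝ) ^ 2))))
        ≤ (1 + β) * ((T + 1 : ℝ) * (C ^ 2 / (2 * y) + 4 * (C ^ 2 / (2 * y)))) := by
          refine mul_le_mul_of_nonneg_left (mul_le_mul (by linarith)
            (add_le_add (hsq _ hs) (by linarith [hsq _ h0])) (by positivity) (by positivity))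
            (by positivity)
      _ = ε / 2 := by
          rw [hy]; field_simp; ring
  have h2 : Real.log (1 / δ) / (1 + β - 1) = ε / 2 := by
    rw [add_sub_cancel_left, div_eq_iff hβ0.ne', hβ]; field_simp
  linarith

/-- A lower bound for the mean term of strong composition, which is `tanh (ε / 2)`. -/
theorem two_fifths_mul_le {ε : ℝ} (h0 : 0 ≤ ε) (h1 : ε ≤ 1) :
    2 / 5 * ε ≤ (Real.exp ε - 1) / (Real.exp ε + 1) := by
  rw [le_div_iff₀ (by positivity)]
  have h2 := Real.quadratic_le_exp_of_nonneg h0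
  nlinarith [mul_le_mul_of_nonneg_left h2 (show 0 ≤ 1 - 2 / 5 * ε by linarith),
    mul_nonneg h0 h0, mul_nonneg h0 (sub_nonneg.2 h1),
    mul_nonneg (mul_nonneg h0 h0) (sub_nonneg.2 h1)]

/-- Comparison of the Rényi bound at the optimal order with strong composition, both divided by
`ε √T`. Here `l` is `log (1 / δ)`, `L` is `log (1.25 / δ)`, so `l - log (T + 1)` is the logarithm
of the reciprocal of the total failure probability `(T + 1) δ`, and `2 / 5` is the slope in
`two_fifths_mul_le`. -/
theorem sqrt_add_le_sqrt {T : ℕ} (hT : 1 ≤ T) {ε l L : ℝ} (h0 : 0 < ε) (h1 : ε < 1)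
    (hl : Real.log (T + 1) ≤ l) (hL : l + 1 / 5 ≤ L) :
    Real.sqrt (5 * (l - Real.log (T + 1)) / (2 * L)) + Real.sqrt T * ε * (5 / (8 * L) - 2 / 5) ≤
      Real.sqrt (2 * l) := by
  have hlog2 := Real.log_two_gt_d9
  have hmono : Real.log 2 ≤ Real.log (T + 1) := by
    apply Real.log_le_log (by norm_num)
    have : (1 : ℝ) ≤ T := by exact_mod_cast hT
    linarith
  have hL0 : 0.89 < L := by linarith
  have hTε : 0 ≤ Real.sqrt T * ε := by positivity
  -- For `L ≥ 25 / 16` the second summand is nonpositive, and `5 / (2 L) ≤ 2`.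
  rcases le_or_gt (25 / 16) L with hbig | hsmall
  · have h2 : 5 / (8 * L) - 2 / 5 ≤ 0 := by
      rw [sub_nonpos, div_le_div_iff₀ (by linarith) (by norm_num)]; linarith
    have h3 : Real.sqrt (5 * (l - Real.log (T + 1)) / (2 * L)) ≤ Real.sqrt (2 * l) := by
      apply Real.sqrt_le_sqrt
      rw [div_le_iff₀ (by linarith)]
      nlinarith
    nlinarith [mul_nonneg hTε (neg_nonneg.2 h2)]
  -- Otherwise `log (T + 1) < 1.37`, which leaves `T = 1` and `T = 2`.
  · have hT2 : T ≤ 2 := by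
      by_contra hcon
      have h3 : (4 : ℝ) ≤ T + 1 := by
        have : (3 : ℝ) ≤ T := by exact_mod_cast (by omega : 3 ≤ T)
        linarith
      have h4 : Real.log 4 ≤ Real.log (T + 1) := Real.log_le_log (by norm_num) h3
      have h5 : Real.log 4 = 2 * Real.log 2 := by
        rw [show (4 : ℝ) = 2 ^ 2 by norm_num, Real.log_pow]; norm_num
      linarith
    -- In each case, `x`, `y`, `z` are numerical bounds for the first root, `√T` and the last factor.
    have key : ∀ x y z : ℝ, 0 ≤ x → 0 ≤ y → 0 ≤ z →
        5 * (l - Real.log (T + 1)) / (2 * L) ≤ x ^ 2 → (T : ℝ) ≤ y ^ 2 →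
        5 / (8 * L) - 2 / 5 ≤ z → (x + y * z) ^ 2 ≤ 2 * l →
        Real.sqrt (5 * (l - Real.log (T + 1)) / (2 * L)) +
          Real.sqrt T * ε * (5 / (8 * L) - 2 / 5) ≤ Real.sqrt (2 * l) := by
      intro x y z hx hy hz hx2 hy2 hz2 hl2
      have e1 := (Real.sqrt_le_left hx).2 hx2
      have e2 := (Real.sqrt_le_left hy).2 hy2
      have e3 : Real.sqrt T * ε * (5 / (8 * L) - 2 / 5) ≤ Real.sqrt T * ε * z := by gcongr
      have e4 : Real.sqrt T * ε * z ≤ y * 1 * z := by gcongr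
      have e5 : x + y * z ≤ Real.sqrt (2 * l) := Real.le_sqrt_of_sq_le hl2
      linarith
    interval_cases T
    · norm_num at hl hmono ⊢
      norm_num at key
      rcases le_or_gt L (5 / 4) with hq | hq
      · refine key 0.85 1 0.303 (by norm_num) (by norm_num) (by norm_num) ?_ (by norm_num) ?_ ?_
        · rw [div_le_iff₀ (by linarith)]; linarith
        · rw [div_le_iff₀ (by linarith)]; linarith
        · norm_num; linarith
      · refine key 1.05 1 0.1 (by norm_num) (by norm_num) (by norm_num) ?_ (by norm_num) ?_ ?_
        · rw [div_le_iff₀ (by linarith)]; linarith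
        · rw [div_le_iff₀ (by linarith)]; linarith
        · norm_num; linarith
    · have hlog3 : 1 < Real.log 3 := by
        rw [Real.lt_log_iff_exp_lt (by norm_num)]
        linarith [Real.exp_one_lt_d9]
      norm_num at hl hmono ⊢
      norm_num at key
      refine key 0.8 1.42 0.13 (by norm_num) (by norm_num) (by norm_num) ?_ (by norm_num) ?_ ?_
      · rw [div_le_iff₀ (by linarith)]; linarith
      · rw [div_le_iff₀ (by linarith)]; linarith
      · norm_num; linarith

theorem div_two_mul_sq_le {C ε δ : ℝ} (hC : 0 < C) (hε : 0 < ε) (hL : 0 < Real.log (1.25 / δ))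
    {σ : ℝ≥0} (hσ : stepNoise C ε δ ≤ σ) :
    C ^ 2 / (2 * (σ : ℝ) ^ 2) ≤ ε ^ 2 / (8 * Real.log (1.25 / δ)) := by
  have h1 : 0 < stepNoise C ε δ := by unfold stepNoise; positivity
  have h2 : stepNoise C ε δ ^ 2 = 4 * Real.log (1.25 / δ) * C ^ 2 / ε ^ 2 := by
    unfold stepNoise
    rw [div_pow, mul_pow, mul_pow, Real.sq_sqrt hL.le]
    norm_num
  calc C ^ 2 / (2 * (σ : ℝ) ^ 2) ≤ C ^ 2 / (2 * stepNoise C ε δ ^ 2) := by gcongr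
    _ = ε ^ 2 / (8 * Real.log (1.25 / δ)) := by
      rw [h2]; field_simp; ring

/-- With the noise of strong composition, some Rényi order already certifies the `ε` of strong
composition at the failure probability `(T + 1) δ`. -/
theorem exists_rdpToEps_le_strongEps {T : ℕ} (hT : 1 ≤ T) {C ε δ : ℝ} (hC : 0 < C)
    (hε : 0 < ε) (hε1 : ε < 1) (hδ : 0 < δ) (hTδ : (T + 1) * δ < 1) {σs σ0 : ℝ≥0}
    (hσs : stepNoise C ε δ ≤ σs) (hσ0 : stepNoise C ε δ ≤ σ0) :
    ∃ α : ℝ, 1 < α ∧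
      rdpToEps α (totalCost T C σs σ0 α) ((T + 1) * δ) ≤ strongEps T ε δ := by
  have hT0 : (0 : ℝ) < T := by exact_mod_cast hT
  set l := Real.log (1 / δ) with hl
  set L := Real.log (1.25 / δ) with hLdef
  have hL : l + 1 / 5 ≤ L := by
    have h1 : L = l + Real.log 1.25 := by
      rw [hLdef, hl, ← Real.log_mul (by positivity) (by norm_num)]
      congr 1; ring
    have h2 := Real.one_sub_inv_le_log_of_pos (show (0 : ℝ) < 1.25 by norm_num)
    norm_num at h1 h2 ⊢
    linarith
  have hl0 : Real.log (1 / ((T + 1) * δ)) = l - Real.log (T + 1) := by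
    rw [hl, ← Real.log_div (by positivity) (by positivity)]
    congr 1; field_simp
  have hl0pos : 0 < l - Real.log (T + 1) := by
    rw [← hl0]
    exact Real.log_pos (by rw [lt_div_iff₀ (by positivity)]; linarith)
  have hlogT : 0 ≤ Real.log ((T : ℝ) + 1) := Real.log_nonneg (by linarith)
  have hL0 : 0 < L := by linarith
  set ρ := 5 * T * ε ^ 2 / (8 * L) with hρ
  have hρ0 : 0 < ρ := by positivity
  -- The order that minimizes `(β + 1) ρ + (l - log (T + 1)) / β` over `β = α - 1`.
  set β := Real.sqrt ((l - Real.log (T + 1)) / ρ) with hβ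
  have hβ0 : 0 < β := Real.sqrt_pos.2 (by positivity)
  have hβ2 : β ^ 2 * ρ = l - Real.log (T + 1) := by
    rw [hβ, Real.sq_sqrt (by positivity)]; field_simp
  refine ⟨1 + β, by linarith, (rdpToEps_le_add_log_div (by linarith)).trans ?_⟩
  have hcost : totalCost T C σs σ0 (1 + β) ≤ (1 + β) * ρ := by
    rw [totalCost_eq]
    have h1 := div_two_mul_sq_le hC hε hL0 hσs
    have h2 := div_two_mul_sq_le hC hε hL0 hσ0
    calc _ ≤ (1 + β) * (T * (ε ^ 2 / (8 * L) + 4 * (ε ^ 2 / (8 * L)))) := by gcongr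
      _ = (1 + β) * ρ := by rw [hρ]; ring
  have hlβ : Real.log (1 / ((T + 1) * δ)) / (1 + β - 1) = β * ρ := by
    rw [hl0, ← hβ2, add_sub_cancel_left, div_eq_iff hβ0.ne']; ring
  have hβρ : 2 * (β * ρ) = ε * Real.sqrt T *
      Real.sqrt (5 * (l - Real.log (T + 1)) / (2 * L)) := by
    have h1 : 0 ≤ 2 * (β * ρ) := by positivity
    have h2 : 0 ≤ ε * Real.sqrt T * Real.sqrt (5 * (l - Real.log (T + 1)) / (2 * L)) := by
      positivity
    rw [← sq_eq_sq₀ h1 h2, mul_pow (ε * _), mul_pow ε, Real.sq_sqrt hT0.le,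
      Real.sq_sqrt (by positivity), ← hβ2, hρ]
    field_simp
    ring
  have hmain := sqrt_add_le_sqrt hT hε hε1 (by linarith : Real.log (T + 1) ≤ l) hL
  have htanh := two_fifths_mul_le hε.le hε1.le
  have hsqT : Real.sqrt T * Real.sqrt T = T := Real.mul_self_sqrt hT0.le
  have hsplit : Real.sqrt (2 * T * l) = Real.sqrt T * Real.sqrt (2 * l) := by
    rw [← Real.sqrt_mul hT0.le]; congr 1; ring
  have h3 := mul_le_mul_of_nonneg_left hmain (show 0 ≤ ε * Real.sqrt T by positivity)
  have h4 : ε * Real.sqrt T * (Real.sqrt T * ε * (5 / (8 * L) - 2 / 5)) =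
      ρ - T * (2 / 5 * ε ^ 2) := by
    rw [hρ]
    linear_combination ε ^ 2 * (5 / (8 * L) - 2 / 5) * hsqT
  have h5 : T * (2 / 5 * ε ^ 2) ≤ T * ((Real.exp ε - 1) / (Real.exp ε + 1)) := by
    gcongr
    nlinarith
  rw [mul_add, h4] at h3
  rw [hlβ, strongEps, ← hl, hsplit]
  linarith

end LOCKS

/-! ### Privacy of the algorithm -/

namespace LOCKS

theorem IsDP.of_one_le {n : ℕ} {𝒟 Ω : Type*} [MeasurableSpace Ω] {M : (Fin n → 𝒟) → Measure Ω}
    [∀ x, IsProbabilityMeasure (M x)] {ε δ : ℝ} (hδ : 1 ≤ δ) : IsDP M ε δ := fun _ _ _ _ _ =>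
  prob_le_one.trans ((ENNReal.one_le_ofReal.2 hδ).trans le_add_self)

namespace Config

variable {n p : ℕ} {𝒳 : Type*} {Kmin Kmax : ℕ}

theorem isDP_of_rdpToEps_le (A : Config n p 𝒳) (T : ℕ) (hC : 0 < A.C) (hσs : 0 < A.σs)
    (hσ0 : 0 < A.σ0) {α ε δ : ℝ} (hα : 1 < α) (hδ : 0 < δ)
    (hε : rdpToEps α (totalCost T A.C A.σs A.σ0 α) δ ≤ ε) :
    IsDP (A.view (Kmin := Kmin) (Kmax := Kmax) T) ε δ ∧
      IsDP (A.output (Kmin := Kmin) (Kmax := Kmax) T) ε δ :=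
  ⟨fun _ _ h _ hS => (A.renyiBound_view hC hσs hσ0 hα h T).measure_le hα hδ hε hS,
    fun _ _ h _ hS => (A.renyiBound_output hC hσs hσ0 hα h T).measure_le hα hδ hε hS⟩

theorem isDP_zero_rounds (A : Config n p 𝒳) {ε δ : ℝ} (hε : 0 ≤ ε) :
    IsDP (A.view (Kmin := Kmin) (Kmax := Kmax) 0) ε δ ∧
      IsDP (A.output (Kmin := Kmin) (Kmax := Kmax) 0) ε δ := by
  have h1 : 1 ≤ ENNReal.ofReal (Real.exp ε) := ENNReal.one_le_ofReal.2 (Real.one_le_exp hε)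
  exact ⟨fun _ _ _ _ _ => (le_mul_of_one_le_left' h1).trans le_self_add,
    fun _ _ _ _ _ => (le_mul_of_one_le_left' h1).trans le_self_add⟩

end Config

end LOCKS

theorem mainTheorem2 {n p : ℕ} {𝒳 : Type*} {Kmin Kmax : ℕ} (hKmin : 1 ≤ Kmin)
    (A : LOCKS.Config n p 𝒳) (T : ℕ)
    (hm : 1 ≤ A.m) (hmn : A.m ≤ n) (hk : 1 ≤ A.k) (hC : 0 < A.C)
    (hσs : 0 < A.σs) (hσ0 : 0 < A.σ0) (hfloor : 0 < A.floor) (hcap : 0 < A.cap)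
    (hloss : ∀ i x, Differentiable ℝ fun w => A.loss i w x) :
    -- strong composition
    (∀ εstep δstep : ℝ, 0 < εstep → εstep < 1 → 0 < δstep → δstep < 1 →
      LOCKS.stepNoise A.C εstep δstep ≤ A.σs →
      LOCKS.stepNoise A.C εstep δstep ≤ A.σ0 →
      LOCKS.IsDP (A.view (Kmin := Kmin) (Kmax := Kmax) T)
          (LOCKS.strongEps T εstep δstep) ((T + 1) * δstep) ∧
        LOCKS.IsDP (A.output (Kmin := Kmin) (Kmax := Kmax) T)
          (LOCKS.strongEps T εstep δstep) ((T + 1) * δstep)) ∧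
    -- Rényi differential privacy
    (∀ α : ℝ, 1 < α →
      LOCKS.IsRDP (A.view (Kmin := Kmin) (Kmax := Kmax) T) α
          (LOCKS.totalCost T A.C A.σs A.σ0 α) ∧
        LOCKS.IsRDP (A.output (Kmin := Kmin) (Kmax := Kmax) T) α
          (LOCKS.totalCost T A.C A.σs A.σ0 α)) ∧
    -- conversion to approximate differential privacy
    (∀ α ε δ : ℝ, 1 < α → 0 ≤ ε → 0 < δ → δ < 1 →
      LOCKS.rdpToEps α (LOCKS.totalCost T A.C A.σs A.σ0 α) δ ≤ ε →
      LOCKS.IsDP (A.view (Kmin := Kmin) (Kmax := Kmax) T) ε δ ∧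
        LOCKS.IsDP (A.output (Kmin := Kmin) (Kmax := Kmax) T) ε δ) ∧
    -- expected charge of each round
    (∀ α : ℝ, 1 < α → ∀ (D : Fin n → LOCKS.LocalData 𝒳 Kmin Kmax) (t : Fin T),
      ∫⁻ s, ENNReal.ofReal (LOCKS.roundCharge A.C A.σs A.σ0 α (s.1 t)) ∂(A.view T D) ≤
        ENNReal.ofReal ((A.m : ℝ) * LOCKS.normCost A.C A.σs α +
          LOCKS.batch A.m A.k * LOCKS.gradCost A.C A.σ0 α)) ∧
    -- noise levels that meet a given privacy target exist
    (∀ ε δ : ℝ, 0 < ε → 0 < δ → δ < 1 →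
      ∃ α : ℝ, 1 < α ∧ ∃ σ : ℝ≥0, 0 < σ ∧ ∀ σs σ0 : ℝ≥0, σ ≤ σs → σ ≤ σ0 →
        LOCKS.rdpToEps α (LOCKS.totalCost T A.C σs σ0 α) δ ≤ ε) := by
  refine ⟨fun εstep δstep hε hε1 hδ hδ1 hs h0 => ?_, fun α hα => ?_, ?_, ?_, ?_⟩
  · rcases Nat.eq_zero_or_pos T with rfl | hT
    · exact A.isDP_zero_rounds (by simp [LOCKS.strongEps])
    rcases le_or_gt 1 ((T + 1) * δstep) with hbig | hsmall
    · exact ⟨LOCKS.IsDP.of_one_le hbig, LOCKS.IsDP.of_one_le hbig⟩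
    · obtain ⟨α, hα, h⟩ := LOCKS.exists_rdpToEps_le_strongEps hT hC hε hε1 hδ hsmall hs h0
      exact A.isDP_of_rdpToEps_le T hC hσs hσ0 hα (by positivity) h
  · exact ⟨fun _ _ h => (A.renyiBound_view hC hσs hσ0 hα h T).renyiDiv_le hα,
      fun _ _ h => (A.renyiBound_output hC hσs hσ0 hα h T).renyiDiv_le hα⟩
  · exact fun α ε δ hα _ hδ _ h => A.isDP_of_rdpToEps_le T hC hσs hσ0 hα hδ h
  · exact fun α hα D t => A.lintegral_roundCharge_view_le (by linarith) (by omega) D T t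
  · exact fun ε δ hε hδ hδ1 => LOCKS.exists_rdpToEps_le T hC hε hδ hδ1
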